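/- For a $4$-polytope $P$ let $f_k$ be its number of $k$-dimensional faces, let $f_{03}$ be the number of incident pairs (vertex, facet), and put $$F(P)=\frac{f_1+f_2-20}{f_0+f_3-10}\quad\text{(fatness)},\qquad C(P)=\frac{f_{03}-20}{f_0+f_3-10}\quad\text{(complexity)}.$$ A polytope is called rational if all its vertices have rational coordinates, and cubical if each of its nonempty proper faces is combinatorially equivalent to a cube. For $n\ge 4$ and $\varepsilon>0$ let $Q^n(\varepsilon)\subset\mathbb R^n$ be the solution set of the $2n$ inequalities $$\pm\varepsilon x_i+\sum_{j<i,\; j< n-4}(-1)^{i-j-1}\binom{3}{i-j-1}x_j\ \le\ \varepsilon^{-2i},\qquad i=0,\dots,n-1,$$ and let $C_4^n=C_4^n(\varepsilon)\subset\mathbb R^4$ be the image of $Q^n(\varepsilon)$ under the projection to the last four coordinates (a Joswig–Ziegler neighborly cubical polytope). There are numbers $\varepsilon_0(n)>0$ such that the following hold. 1. For every $n\ge4$ and every rational $\varepsilon$ with $0<\varepsilon<\varepsilon_0(n)$, the set $Q^n(\varepsilon)$ is a polytope combinatorially equivalent to the $n$-cube, and $C_4^n(\varepsilon)$ is a rational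 cubical $4$-polytope whose graph is isomorphic to the graph of the $n$-cube and whose flag-vector is $$(f_0,f_1,f_2,f_3;f_{03})=\bigl(4,\,2n,\,3(n-2),\,n-2;\,8(n-2)\bigr)\cdot 2^{n-2}.$$ 2. As $n\to\infty$, $F(C_4^n(\varepsilon))\to5$ and $C(C_4^n(\varepsilon))\to8$, uniformly over all rational $0<\varepsilon<\varepsilon_0(n)$. Hence for every $\delta>0$ there is a rational $4$-polytope $P$ with $|F(P)-5|<\delta$ and $|C(P)-8|<\delta$. -/

import Mathlib

noncomputable section

namespace PolytopeFaces

/-- A convex polytope in `ℝ^d`: the convex hull of finitely many points. -/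
def IsPolytope {d : ℕ} (P : Set (EuclideanSpace ℝ (Fin d))) : Prop :=
  ∃ V : Finset (EuclideanSpace ℝ (Fin d)), P = convexHull ℝ (V : Set (EuclideanSpace ℝ (Fin d)))

/-- The dimension of (the affine hull of) a nonempty subset of `ℝ^d`. -/
def affDim {d : ℕ} (P : Set (EuclideanSpace ℝ (Fin d))) : ℕ :=
  Module.finrank ℝ (vectorSpan ℝ P)

/-- A `d`-polytope in `ℝ^d`, that is, a full-dimensional one. -/
def IsFullPolytope {d : ℕ} (P : Set (EuclideanSpace ℝ (Fin d))) : Prop :=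
  IsPolytope P ∧ P.Nonempty ∧ affDim P = d

/-- All vertices have rational coordinates. -/
def IsRational {d : ℕ} (P : Set (EuclideanSpace ℝ (Fin d))) : Prop :=
  ∀ v ∈ P.extremePoints ℝ, ∀ i, ∃ q : ℚ, v i = (q : ℝ)

/-- The faces of a polytope: `∅` and all sets of points where a linear functional attains its
maximum over `P` (the zero functional gives `P` itself), ordered by inclusion. -/
abbrev Face {d : ℕ} (P : Set (EuclideanSpace ℝ (Fin d))) : Type :=
  {F : Set (EuclideanSpace ℝ (Fin d)) // IsExposed ℝ P F}

/-- Combinatorial equivalence: isomorphism of the face lattices. -/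
def CombEquiv {d e : ℕ} (P : Set (EuclideanSpace ℝ (Fin d)))
    (Q : Set (EuclideanSpace ℝ (Fin e))) : Prop :=
  Nonempty (Face P ≃o Face Q)

/-- The `k`-dimensional faces. -/
def IsKFace {d : ℕ} (P : Set (EuclideanSpace ℝ (Fin d))) (k : ℕ)
    (F : Set (EuclideanSpace ℝ (Fin d))) : Prop :=
  IsExposed ℝ P F ∧ F.Nonempty ∧ affDim F = k

/-- `f_k`, the number of `k`-dimensional faces. -/
def faceNumber {d : ℕ} (P : Set (EuclideanSpace ℝ (Fin d))) (k : ℕ) : ℕ :=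
  {F | IsKFace P k F}.ncard

/-- `f_{kl}` for `k < l`, the number of incident pairs of a `k`-face and an `l`-face. -/
def flagNumber {d : ℕ} (P : Set (EuclideanSpace ℝ (Fin d))) (k l : ℕ) : ℕ :=
  {p : Set (EuclideanSpace ℝ (Fin d)) × Set (EuclideanSpace ℝ (Fin d)) |
    IsKFace P k p.1 ∧ IsKFace P l p.2 ∧ p.1 ⊆ p.2}.ncard

/-- The flag-vector `(f_0, f_1, f_2, f_3; f_{03})` of a 4-polytope. -/
def flagVector (P : Set (EuclideanSpace ℝ (Fin 4))) : ℕ × ℕ × ℕ × ℕ × ℕ :=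
  (faceNumber P 0, faceNumber P 1, faceNumber P 2, faceNumber P 3, flagNumber P 0 3)

/-- Fatness `(f_1 + f_2 - 20) / (f_0 + f_3 - 10)`. -/
def fatness (P : Set (EuclideanSpace ℝ (Fin 4))) : ℝ :=
  ((faceNumber P 1 : ℝ) + faceNumber P 2 - 20) / ((faceNumber P 0 : ℝ) + faceNumber P 3 - 10)

/-- Complexity `(f_{03} - 20) / (f_0 + f_3 - 10)`. -/
def complexity (P : Set (EuclideanSpace ℝ (Fin 4))) : ℝ :=
  ((flagNumber P 0 3 : ℝ) - 20) / ((faceNumber P 0 : ℝ) + faceNumber P 3 - 10)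

/-- The standard cube `[0,1]^k`. -/
def stdCube (k : ℕ) : Set (EuclideanSpace ℝ (Fin k)) :=
  {x | ∀ i, x i ∈ Set.Icc (0 : ℝ) 1}

/-- A cubical polytope: every nonempty proper face is combinatorially a cube. -/
def IsCubical {d : ℕ} (P : Set (EuclideanSpace ℝ (Fin d))) : Prop :=
  ∀ F, IsExposed ℝ P F → F.Nonempty → F ≠ P → CombEquiv F (stdCube (affDim F))

/-- The graph of a polytope: its vertices and edges. -/
def polytopeGraph {d : ℕ} (P : Set (EuclideanSpace ℝ (Fin d))) :
    SimpleGraph (P.extremePoints ℝ) where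
  Adj u v := u ≠ v ∧ IsExposed ℝ P (segment ℝ (u : EuclideanSpace ℝ (Fin d)) v)
  symm := ⟨fun u v h => ⟨h.1.symm, by rw [segment_symm]; exact h.2⟩⟩
  loopless := ⟨fun _ h => h.1 rfl⟩

/-- The graph of the `n`-cube: 0/1-strings, adjacent if they differ in exactly one place. -/
def cubeGraph (n : ℕ) : SimpleGraph (Fin n → Bool) where
  Adj u v := hammingDist u v = 1
  symm := ⟨fun u v h => by rw [hammingDist_comm]; exact h⟩
  loopless := ⟨fun u h => by simp at h⟩

/-- The strictly lower triangular part of the inequality system of the deformed cube. Only the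
first `n - 4` columns are nonzero; each of these has the entries `1, -3, 3, -1` directly below the
diagonal. The rows `1, …, n - 1` (counted from `0`), restricted to those columns, form a Gale
transform of the cyclic polygon with the vertices `(t, t ^ 2)`, `t = 1, …, n - 1`. -/
def galeEntry (n : ℕ) (i j : Fin n) : ℝ :=
  if (j : ℕ) + 4 < n ∧ j < i then
    (-1) ^ ((i : ℕ) - j - 1) * (Nat.choose 3 ((i : ℕ) - j - 1) : ℝ)
  else 0

/-- The deformed `n`-cube, given by the `2n` linear inequalities
`± ε x_i + ∑_{j < i} g_{ij} x_j ≤ ε^{-2i}`. -/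
def deformedCube (n : ℕ) (ε : ℝ) : Set (EuclideanSpace ℝ (Fin n)) :=
  {x | ∀ i : Fin n, ε * |x i| + ∑ j, galeEntry n i j * x j ≤ (ε⁻¹) ^ (2 * (i : ℕ))}

/-- The projection of `ℝ^n` to the last four coordinates. -/
def lastFour (n : ℕ) (hn : 4 ≤ n) (x : EuclideanSpace ℝ (Fin n)) : EuclideanSpace ℝ (Fin 4) :=
  WithLp.toLp 2 fun k : Fin 4 => x ⟨n - 4 + k, by omega⟩

/-- The neighborly cubical polytope `C_4^n` (with deformation parameter `ε`): the projection of the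
deformed `n`-cube to the last four coordinates. -/
def neighborlyCubical (n : ℕ) (hn : 4 ≤ n) (ε : ℝ) : Set (EuclideanSpace ℝ (Fin 4)) :=
  lastFour n hn '' deformedCube n ε

end PolytopeFaces

end

open PolytopeFaces

open PolytopeFaces

namespace PolytopeFaces

open Filter Topology

/-! The facet normals of `deformedCube` are `g_i ± ε e_i`, where `g_i` are the rows of `galeEntry`.
The system is triangular and its right-hand sides grow so fast that the lower terms never decide a
row. Hence the nonempty faces are indexed by sign vectors `σ`: `σ i = ±1` makes one of the two
inequalities of row `i` tight, and `σ i = 0` leaves both free. Every linear functional is `∑ |y_i|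
g_i + ε ∑ y_i e_i` for some `y`, and attains its maximum over the cube exactly on the face with
signs `sign y` (`SmallParam.cubeFace_argmax`).

Faces of the projection come from functionals whose first `n - 4` coefficients vanish. With `a =
|y|` and `s` the signs of `y`, this condition is the recursion `a (j+4) = 3 a (j+3) - 3 a (j+2) + a
(j+1) + ε s_j a_j`. So the faces of `C_4^n` correspond to the sign vectors of such `y`
(`realizable_iff`, `SmallParam.exposed_projFace`, `SmallParam.exists_eq_projFace_of_exposed`). A
nonzero vector with `k` zeros gives a `k`-face.

For `ε = 0` the solutions are quadratic polynomials on the indices from `1` on, with a free value at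
`0`. Two facts about quadratics survive for small `ε > 0`, uniformly in the signs by compactness.
Vandermonde determinants show that a nonzero solution has at most three zeros
(`eventually_generalPosition`); therefore proper faces project injectively and are cubes. The square
`(t - z)^2` vanishes only at `z`, so every sign vector with at most one zero occurs
(`eventually_realizable`); therefore all vertices and edges of the `n`-cube survive, which gives the
graph, `f_0 = 2^n` and `f_1 = n 2^(n-1)`.

Euler's relation (`euler_relation`) and `2 f_2 = 6 f_3` (each 2-face lies in two facets, each facet
is a 3-cube) determine `f_2` and `f_3`, and `f_03 = 8 f_3`. After division by `2^(n-2)` the leading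
terms of fatness and complexity are `5n / n` and `8n / n`. -/

/-! ### The four-term recursion and its quadratic limit -/

/-- The sequence with initial values `v` that solves
`a (j + 4) = 3 a (j + 3) - 3 a (j + 2) + a (j + 1) + ε s_j a_j`. -/
def recSol (ε : ℝ) (s : ℕ → ℝ) (v : Fin 4 → ℝ) : ℕ → ℝ
  | 0 => v 0
  | 1 => v 1
  | 2 => v 2
  | 3 => v 3
  | j + 4 => 3 * recSol ε s v (j + 3) - 3 * recSol ε s v (j + 2) + recSol ε s v (j + 1)
      + ε * s j * recSol ε s v j

/-- Two sequences that satisfy the same four-term recursion up to the index `n` and have the same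
initial values agree up to `n`. -/
theorem eq_recSol_of_rec {ε : ℝ} {s : ℕ → ℝ} {v : Fin 4 → ℝ} {n : ℕ} {a : ℕ → ℝ}
    (h0 : ∀ k : Fin 4, a k = v k)
    (h : ∀ j, j + 4 < n → a (j + 4) = 3 * a (j + 3) - 3 * a (j + 2) + a (j + 1) + ε * s j * a j) :
    ∀ t < n, recSol ε s v t = a t := by
  intro t
  induction t using Nat.strong_induction_on with
  | _ t ih =>
    intro ht
    match t, ih, ht with
    | 0, _, _ => simpa [recSol] using (h0 0).symm
    | 1, _, _ => simpa [recSol] using (h0 1).symm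
    | 2, _, _ => simpa [recSol] using (h0 2).symm
    | 3, _, _ => simpa [recSol] using (h0 3).symm
    | j + 4, ih, ht =>
      rw [recSol, ih (j + 3) (by omega) (by omega), ih (j + 2) (by omega) (by omega),
        ih (j + 1) (by omega) (by omega), ih j (by omega) (by omega), h j ht]

theorem recSol_add (ε : ℝ) (s : ℕ → ℝ) (v w : Fin 4 → ℝ) (t : ℕ) :
    recSol ε s (v + w) t = recSol ε s v t + recSol ε s w t := by
  refine eq_recSol_of_rec (n := t + 1) (a := fun t => recSol ε s v t + recSol ε s w t) ?_ ?_ t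
    (Nat.lt_succ_self t)
  · intro k; fin_cases k <;> simp [recSol]
  · intro j _; simp only [recSol]; ring

theorem recSol_smul (ε : ℝ) (s : ℕ → ℝ) (c : ℝ) (v : Fin 4 → ℝ) (t : ℕ) :
    recSol ε s (c • v) t = c * recSol ε s v t := by
  refine eq_recSol_of_rec (n := t + 1) (a := fun t => c * recSol ε s v t) ?_ ?_ t
    (Nat.lt_succ_self t)
  · intro k; fin_cases k <;> simp [recSol]
  · intro j _; simp only [recSol]; ring

theorem recSol_zero (ε : ℝ) (s : ℕ → ℝ) (t : ℕ) : recSol ε s 0 t = 0 := by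
  simpa using recSol_smul ε s 0 0 t

theorem recSol_sub (ε : ℝ) (s : ℕ → ℝ) (v w : Fin 4 → ℝ) (t : ℕ) :
    recSol ε s (v - w) t = recSol ε s v t - recSol ε s w t := by
  have h := recSol_add ε s (v - w) w t
  rw [sub_add_cancel] at h
  linarith

theorem continuous_recSol (v : Fin 4 → ℝ) (t : ℕ) :
    Continuous fun p : ℝ × (ℕ → ℝ) => recSol p.1 p.2 v t := by
  induction t using Nat.strong_induction_on with
  | _ t ih =>
    match t, ih with
    | 0, _ => simpa only [recSol] using continuous_const
    | 1, _ => simpa only [recSol] using continuous_const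
    | 2, _ => simpa only [recSol] using continuous_const
    | 3, _ => simpa only [recSol] using continuous_const
    | j + 4, ih =>
      have h0 := ih j (by omega)
      have h1 := ih (j + 1) (by omega)
      have h2 := ih (j + 2) (by omega)
      have h3 := ih (j + 3) (by omega)
      simp only [recSol]
      fun_prop

/-- For `ε = 0` the solutions are quadratic from the index `1` on. -/
theorem recSol_zero_left (s : ℕ → ℝ) (c α β γ : ℝ) {t : ℕ} (ht : 1 ≤ t) :
    recSol 0 s ![c, α + β + γ, α + β * 2 + γ * 4, α + β * 3 + γ * 9] t
      = α + β * t + γ * (t : ℝ) ^ 2 := by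
  have h := eq_recSol_of_rec (ε := 0) (s := s) (n := t + 1)
    (v := ![c, α + β + γ, α + β * 2 + γ * 4, α + β * 3 + γ * 9])
    (a := fun t => if t = 0 then c else α + β * t + γ * (t : ℝ) ^ 2) ?_ ?_ t (Nat.lt_succ_self t)
  · rw [h, if_neg (by omega)]
  · intro k
    fin_cases k <;> norm_num
  · intro j _
    simp only [Nat.add_eq_zero_iff, OfNat.ofNat_ne_zero, one_ne_zero, and_false, if_false]
    push_cast
    ring

/-! ### General position of the evaluations, uniformly in the signs -/

/-- Sequences of signs, as real numbers. -/
def signSeq : Set (ℕ → ℝ) := Set.pi Set.univ fun _ => {1, -1}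

theorem isCompact_signSeq : IsCompact signSeq :=
  isCompact_univ_pi fun _ => (Set.toFinite _).isCompact

theorem mem_signSeq {s : ℕ → ℝ} : s ∈ signSeq ↔ ∀ i, s i = 1 ∨ s i = -1 := by
  simp [signSeq]

/-- Tube lemma over the compact space of sign sequences: a condition checked at `ε = 0` for each `s`
yields one neighbourhood of `0` that serves all `s`. -/
theorem eventually_signSeq_of_ne_zero {f : ℝ × (ℕ → ℝ) → ℝ} (hf : Continuous f)
    (h0 : ∀ s ∈ signSeq, f (0, s) ≠ 0) : ∀ᶠ ε in 𝓝 (0 : ℝ), ∀ s ∈ signSeq, f (ε, s) ≠ 0 :=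
  isCompact_signSeq.eventually_forall_of_forall_eventually (P := fun ε s => f (ε, s) ≠ 0)
    fun s hs => hf.continuousAt.eventually_ne (h0 s hs)

theorem eventually_signSeq_pos {f : ℝ × (ℕ → ℝ) → ℝ} (hf : Continuous f)
    (h0 : ∀ s ∈ signSeq, 0 < f (0, s)) : ∀ᶠ ε in 𝓝 (0 : ℝ), ∀ s ∈ signSeq, 0 < f (ε, s) :=
  isCompact_signSeq.eventually_forall_of_forall_eventually (P := fun ε s => 0 < f (ε, s))
    fun s hs => hf.continuousAt.eventually_const_lt (h0 s hs)

/-- The values at `i, j, k` of the three solutions starting with `0` and the monomial `t ^ m`. -/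
def monomialMatrix (ε : ℝ) (s : ℕ → ℝ) (i j k : ℕ) : Matrix (Fin 3) (Fin 3) ℝ :=
  Matrix.of fun a m => recSol ε s ![0, 1, 2 ^ (m : ℕ), 3 ^ (m : ℕ)] (![i, j, k] a)

/-- At `ε = 0` the matrix is the Vandermonde matrix of `i, j, k`. The restriction `0 < i` matters
because the limit is quadratic only from the index `1` on. -/
theorem eventually_det_monomialMatrix_ne_zero {i j k : ℕ} (hi : 0 < i) (hij : i < j)
    (hjk : j < k) :
    ∀ᶠ ε in 𝓝 (0 : ℝ), ∀ s ∈ signSeq, (monomialMatrix ε s i j k).det ≠ 0 := by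
  refine eventually_signSeq_of_ne_zero
    (f := fun p => (monomialMatrix p.1 p.2 i j k).det) ?_ ?_
  · refine Continuous.matrix_det ?_
    exact continuous_matrix fun a m => continuous_recSol _ _
  · intro s _
    have key : ∀ t : ℕ, 1 ≤ t → recSol 0 s ![0, 1, 1, 1] t = 1 ∧
        recSol 0 s ![0, 1, 2, 3] t = t ∧ recSol 0 s ![0, 1, 4, 9] t = (t : ℝ) ^ 2 := by
      intro t ht
      refine ⟨?_, ?_, ?_⟩
      · simpa using recSol_zero_left s 0 1 0 0 ht
      · simpa using recSol_zero_left s 0 0 1 0 ht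
      · simpa using recSol_zero_left s 0 0 0 1 ht
    obtain ⟨a0, a1, a2⟩ := key i hi
    obtain ⟨b0, b1, b2⟩ := key j (by omega)
    obtain ⟨c0, c1, c2⟩ := key k (by omega)
    have hdet : (monomialMatrix 0 s i j k).det = ((j : ℝ) - i) * ((k : ℝ) - i) * (k - j) := by
      rw [Matrix.det_fin_three]
      norm_num [monomialMatrix, show (![i, j, k] : Fin 3 → ℕ) 2 = k from rfl, a0, a1, a2, b0, b1, b2, c0, c1, c2]
      ring
    change (monomialMatrix 0 s i j k).det ≠ 0
    rw [hdet]
    have h1 : (i : ℝ) < j := by exact_mod_cast hij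
    have h2 : (j : ℝ) < k := by exact_mod_cast hjk
    have : 0 < ((j : ℝ) - i) * ((k : ℝ) - i) * (k - j) :=
      mul_pos (mul_pos (by linarith) (by linarith)) (by linarith)
    exact this.ne'

/-- Four evaluations at indices below `n` are independent on the solution space. -/
def GeneralPosition (ε : ℝ) (n : ℕ) : Prop :=
  ∀ s ∈ signSeq, ∀ v : Fin 4 → ℝ, ∀ Z : Finset ℕ, Z ⊆ Finset.range n → 4 ≤ Z.card →
    (∀ i ∈ Z, recSol ε s v i = 0) → v = 0

theorem GeneralPosition.mono {ε : ℝ} {m n : ℕ} (h : GeneralPosition ε n) (hmn : m ≤ n) :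
    GeneralPosition ε m := fun s hs v Z hZ =>
  h s hs v Z (hZ.trans (Finset.range_subset_range.2 hmn))

/-- Lets the first zero of a solution be moved to the index `0`, so that only three further zeros
need a determinant. -/
theorem recSol_shift (ε : ℝ) (s : ℕ → ℝ) (v : Fin 4 → ℝ) (m t : ℕ) :
    recSol ε (fun k => s (m + k)) (fun k => recSol ε s v (m + k)) t = recSol ε s v (m + t) := by
  refine eq_recSol_of_rec (n := t + 1) (a := fun t => recSol ε s v (m + t)) (fun k => rfl) ?_ t
    (Nat.lt_succ_self t)
  intro j _
  change recSol ε s v (m + j + 4) = _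
  rw [recSol]
  rfl

/-- A solution with a zero at `0` and three further zeros vanishes. -/
theorem recSol_initial_eq_zero {ε : ℝ} {s : ℕ → ℝ} {v : Fin 4 → ℝ} {i j k : ℕ}
    (hdet : (monomialMatrix ε s i j k).det ≠ 0) (h0 : v 0 = 0) (hi : recSol ε s v i = 0)
    (hj : recSol ε s v j = 0) (hk : recSol ε s v k = 0) : v = 0 := by
  -- `α, β, γ` are the coefficients of the quadratic that interpolates `v` at `1, 2, 3`; with `v 0 =
  -- 0` they describe `v` completely.
  set γ := (v 3 - 2 * v 2 + v 1) / 2 with hγ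
  set β := v 2 - v 1 - 3 * γ with hβ
  set α := v 1 - β - γ with hα
  have hv : v = α • ![0, 1, 2 ^ 0, 3 ^ 0] + β • ![0, 1, 2 ^ 1, 3 ^ 1]
      + γ • ![0, 1, 2 ^ 2, 3 ^ 2] := by
    funext m
    fin_cases m
    · simp [h0]
    · simp [hα]; ring
    · simp [hα, hβ]; ring
    · simp [hα, hβ, hγ]; ring
  have hval : ∀ t, recSol ε s v t = α * recSol ε s ![0, 1, 2 ^ 0, 3 ^ 0] t
      + β * recSol ε s ![0, 1, 2 ^ 1, 3 ^ 1] t + γ * recSol ε s ![0, 1, 2 ^ 2, 3 ^ 2] t := by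
    intro t
    conv_lhs => rw [hv]
    rw [recSol_add, recSol_add, recSol_smul, recSol_smul, recSol_smul]
  have hM : (monomialMatrix ε s i j k).mulVec ![α, β, γ] = 0 := by
    funext a
    rw [hval] at hi hj hk
    fin_cases a
    · simp only [Matrix.mulVec, dotProduct, Fin.sum_univ_three]
      simpa [monomialMatrix, mul_comm] using hi
    · simp only [Matrix.mulVec, dotProduct, Fin.sum_univ_three]
      simpa [monomialMatrix, mul_comm] using hj
    · simp only [Matrix.mulVec, dotProduct, Fin.sum_univ_three]
      simpa [monomialMatrix, mul_comm] using hk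
  have hz := Matrix.eq_zero_of_mulVec_eq_zero hdet hM
  have h1 : α = 0 := congrFun hz 0
  have h2 : β = 0 := congrFun hz 1
  have h3 : γ = 0 := congrFun hz 2
  rw [hv, h1, h2, h3]
  simp

/-- A solution that vanishes at four consecutive places vanishes. -/
theorem recSol_backward {ε : ℝ} (hε : ε ≠ 0) {s : ℕ → ℝ} (hs : s ∈ signSeq) {v : Fin 4 → ℝ} {m : ℕ}
    (h : ∀ k : Fin 4, recSol ε s v (m + k) = 0) : v = 0 := by
  induction m with
  | zero =>
    funext k
    have := h k
    fin_cases k <;> simpa [recSol] using this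
  | succ m ih =>
    apply ih
    have h0 := h 0
    have h1 := h 1
    have h2 := h 2
    have h3 := h 3
    simp only [Fin.val_zero, Fin.val_one, Fin.val_two, add_zero] at h0 h1 h2
    rw [show m + 1 + ((3 : Fin 4) : ℕ) = m + 4 from rfl, recSol, show m + 3 = m + 1 + 2 from rfl,
      h2, show m + 2 = m + 1 + 1 from rfl, h1, h0] at h3
    have hsm : s m ≠ 0 := by rcases mem_signSeq.1 hs m with h | h <;> rw [h] <;> norm_num
    have hm : recSol ε s v m = 0 := by
      have : ε * s m * recSol ε s v m = 0 := by linarith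
      simpa [hε, hsm] using this
    intro k
    fin_cases k
    · simpa using hm
    · simpa using h0
    · simpa using h1
    · simpa using h2

/-- Shifting the smallest of four zeros to `0` and applying the determinant shows that the solution
vanishes at four consecutive places; running the recursion backwards then kills it. The backward
step divides by `ε`, hence the one-sided neighbourhood. -/
theorem eventually_generalPosition (n : ℕ) : ∀ᶠ ε in 𝓝[>] (0 : ℝ), GeneralPosition ε n := by
  have h : ∀ᶠ ε in 𝓝 (0 : ℝ), ∀ i j k : Fin n, 0 < (i : ℕ) → i < j → j < k →
      ∀ s ∈ signSeq, (monomialMatrix ε s i j k).det ≠ 0 := by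
    simp only [eventually_all]
    exact fun i j k hi hij hjk => eventually_det_monomialMatrix_ne_zero hi hij hjk
  filter_upwards [h.filter_mono nhdsWithin_le_nhds, self_mem_nhdsWithin] with ε hε hpos
  intro s hs v Z hZ hcard hzero
  obtain ⟨Z', hZ'Z, hZ'⟩ := Finset.exists_subset_card_eq hcard
  set e := Z'.orderEmbOfFin hZ' with he
  have hmem : ∀ a, e a ∈ Z := fun a => hZ'Z (Z'.orderEmbOfFin_mem hZ' a)
  have hlt : ∀ a, e a < n := fun a => Finset.mem_range.1 (hZ (hmem a))
  have h01 : e 0 < e 1 := e.strictMono (by decide)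
  have h12 : e 1 < e 2 := e.strictMono (by decide)
  have h23 : e 2 < e 3 := e.strictMono (by decide)
  have hs' : (fun k => s (e 0 + k)) ∈ signSeq :=
    mem_signSeq.2 fun i => mem_signSeq.1 hs _
  have hdet := hε ⟨e 1 - e 0, by have := hlt 1; omega⟩ ⟨e 2 - e 0, by have := hlt 2; omega⟩
    ⟨e 3 - e 0, by have := hlt 3; omega⟩ (by simp) (by simp [Fin.lt_def]; omega)
    (by simp [Fin.lt_def]; omega) _ hs'
  have hval : ∀ a, 0 < a → recSol ε (fun k => s (e 0 + k)) (fun k => recSol ε s v (e 0 + k))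
      (e a - e 0) = 0 := by
    intro a ha
    have : e 0 < e a := e.strictMono ha
    rw [recSol_shift, Nat.add_sub_cancel' this.le]
    exact hzero _ (hmem a)
  have hz := recSol_initial_eq_zero (v := fun k : Fin 4 => recSol ε s v (e 0 + k)) hdet
    (by simpa using hzero _ (hmem 0)) (hval 1 (by decide)) (hval 2 (by decide))
    (hval 3 (by decide))
  exact recSol_backward (ne_of_gt hpos) hs (m := e 0) fun k => congrFun hz k

/-- Values at no more than four places can be prescribed. -/
theorem GeneralPosition.exists_eq {ε : ℝ} {n : ℕ} (h : GeneralPosition ε n) (hn : 4 ≤ n)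
    {s : ℕ → ℝ} (hs : s ∈ signSeq) {Z : Finset ℕ} (hZ : Z ⊆ Finset.range n) (hcard : Z.card ≤ 4)
    (f : ℕ → ℝ) : ∃ v, ∀ i ∈ Z, recSol ε s v i = f i := by
  -- Enlarging to exactly four places makes evaluation an endomorphism of a 4-dimensional space, so
  -- injectivity gives surjectivity.
  obtain ⟨T, hZT, hT, hTc⟩ := Finset.exists_subsuperset_card_eq hZ hcard (by simpa using hn)
  let e := T.orderEmbOfFin hTc
  let A : (Fin 4 → ℝ) →ₗ[ℝ] (Fin 4 → ℝ) :=
    { toFun := fun v a => recSol ε s v (e a)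
      map_add' := fun v w => funext fun a => recSol_add ε s v w _
      map_smul' := fun c v => funext fun a => recSol_smul ε s c v _ }
  have hrange : ∀ i ∈ T, ∃ a, e a = i := by
    intro i hi
    have : i ∈ Set.range e := by rw [Finset.range_orderEmbOfFin]; exact hi
    exact this
  have hinj : Function.Injective A := by
    rw [← LinearMap.ker_eq_bot, LinearMap.ker_eq_bot']
    intro v hv
    refine h s hs v T hT hTc.ge fun i hi => ?_
    obtain ⟨a, rfl⟩ := hrange i hi
    exact congrFun hv a
  obtain ⟨v, hv⟩ := LinearMap.injective_iff_surjective.1 hinj fun a => f (e a)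
  refine ⟨v, fun i hi => ?_⟩
  obtain ⟨a, rfl⟩ := hrange i (hZT hi)
  exact congrFun hv a

/-! ### Realizable sign vectors and neighborliness -/

/-- The solution with a double zero at `z` of the limiting quadratic is positive elsewhere. -/
theorem eventually_recSol_pos (n : ℕ) : ∀ᶠ ε in 𝓝 (0 : ℝ), ∀ z : Fin (n + 1), 0 < (z : ℕ) →
    ∀ t : Fin n, (t : ℕ) ≠ z → ∀ s ∈ signSeq,
      0 < recSol ε s ![0, 1, 1, 1] z
          * recSol ε s ![1, (1 - (z : ℝ)) ^ 2, (2 - (z : ℝ)) ^ 2, (3 - (z : ℝ)) ^ 2] t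
        - recSol ε s ![1, (1 - (z : ℝ)) ^ 2, (2 - (z : ℝ)) ^ 2, (3 - (z : ℝ)) ^ 2] z
          * recSol ε s ![0, 1, 1, 1] t := by
  simp only [eventually_all]
  intro z hz t htz
  have hc := continuous_recSol
  refine eventually_signSeq_pos (f := fun p => recSol p.1 p.2 ![0, 1, 1, 1] z
          * recSol p.1 p.2 ![1, (1 - (z : ℝ)) ^ 2, (2 - (z : ℝ)) ^ 2, (3 - (z : ℝ)) ^ 2] t
        - recSol p.1 p.2 ![1, (1 - (z : ℝ)) ^ 2, (2 - (z : ℝ)) ^ 2, (3 - (z : ℝ)) ^ 2] z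
          * recSol p.1 p.2 ![0, 1, 1, 1] t)
    (((hc _ _).mul (hc _ _)).sub ((hc _ _).mul (hc _ _))) ?_
  intro s _
  have h1 : ∀ t : ℕ, 1 ≤ t → recSol 0 s ![0, 1, 1, 1] t = 1 := fun t ht => by
    simpa using recSol_zero_left s 0 1 0 0 ht
  have h2 : ∀ t : ℕ, 1 ≤ t → recSol 0 s
      ![1, (1 - (z : ℝ)) ^ 2, (2 - (z : ℝ)) ^ 2, (3 - (z : ℝ)) ^ 2] t = ((t : ℝ) - z) ^ 2 := by
    intro t ht
    rw [show (1 - (z : ℝ)) ^ 2 = (z : ℝ) ^ 2 + -2 * z + 1 by ring,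
      show (2 - (z : ℝ)) ^ 2 = (z : ℝ) ^ 2 + -2 * z * 2 + 1 * 4 by ring,
      show (3 - (z : ℝ)) ^ 2 = (z : ℝ) ^ 2 + -2 * z * 3 + 1 * 9 by ring,
      recSol_zero_left s 1 ((z : ℝ) ^ 2) (-2 * z) 1 ht]
    ring
  change 0 < recSol 0 s ![0, 1, 1, 1] z
          * recSol 0 s ![1, (1 - (z : ℝ)) ^ 2, (2 - (z : ℝ)) ^ 2, (3 - (z : ℝ)) ^ 2] t
        - recSol 0 s ![1, (1 - (z : ℝ)) ^ 2, (2 - (z : ℝ)) ^ 2, (3 - (z : ℝ)) ^ 2] z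
          * recSol 0 s ![0, 1, 1, 1] t
  rw [h1 z hz, h2 z hz]
  rcases Nat.eq_zero_or_pos (t : ℕ) with ht | ht
  · rw [ht]; simp [recSol]
  · rw [h2 t ht]
    have : ((t : ℕ) : ℝ) - z ≠ 0 := sub_ne_zero.2 (by exact_mod_cast htz)
    have : 0 < (((t : ℕ) : ℝ) - z) ^ 2 := by positivity
    simpa using this

/-- Covers a zero at the index `0`, where the free initial value replaces the double zero of a
quadratic. -/
theorem eventually_recSol_pos_of_zero (n : ℕ) : ∀ᶠ ε in 𝓝 (0 : ℝ), ∀ t : Fin n, 0 < (t : ℕ) →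
    ∀ s ∈ signSeq, 0 < recSol ε s ![0, 1, 1, 1] t := by
  simp only [eventually_all]
  intro t ht
  refine eventually_signSeq_pos (f := fun p => recSol p.1 p.2 ![0, 1, 1, 1] t)
    (continuous_recSol _ _) fun s _ => ?_
  have : recSol 0 s ![0, 1, 1, 1] t = 1 := by
    simpa using recSol_zero_left s 0 1 0 0 (Nat.succ_le_of_lt ht)
  change 0 < recSol 0 s ![0, 1, 1, 1] t
  rw [this]; exact one_pos

/-- The sign vector `σ` occurs as the sign vector of a solution of
`ε y_j + |y (j + 1)| - 3 |y (j + 2)| + 3 |y (j + 3)| - |y (j + 4)| = 0`. -/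
def Realizable (ε : ℝ) (n : ℕ) (σ : Fin n → SignType) : Prop :=
  ∃ y : ℕ → ℝ, (∀ j, j + 4 < n →
      ε * y j + (|y (j + 1)| - 3 * |y (j + 2)| + 3 * |y (j + 3)| - |y (j + 4)|) = 0) ∧
    ∀ i : Fin n, SignType.sign (y i) = σ i

/-- The sign sequence `s` has the signs `σ` wherever `σ` is nonzero. -/
def Fills {n : ℕ} (s : ℕ → ℝ) (σ : Fin n → SignType) : Prop :=
  s ∈ signSeq ∧ ∀ i : Fin n, σ i ≠ 0 → s i = (σ i : ℝ)

theorem exists_fills {n : ℕ} (σ : Fin n → SignType) : ∃ s, Fills s σ := by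
  refine ⟨fun i => if h : i < n then (if σ ⟨i, h⟩ = -1 then -1 else 1) else 1,
    mem_signSeq.2 fun i => ?_, fun i hi => ?_⟩
  · split_ifs <;> simp
  · simp only [i.isLt, dite_true, Fin.eta]
    cases h : σ i <;> simp_all

/-- Once the signs are fixed the absolute values become linear: `|y|` solves the recursion. The
values of `s` at zeros of `σ` are irrelevant, so one `s` serves a cell and all its boundary cells.
-/
theorem Realizable.exists_recSol {ε : ℝ} {n : ℕ} {σ : Fin n → SignType} (h : Realizable ε n σ)
    {s : ℕ → ℝ} (hs : Fills s σ) :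
    ∃ v, ∀ i : Fin n, 0 ≤ recSol ε s v i ∧ (recSol ε s v i = 0 ↔ σ i = 0) := by
  obtain ⟨y, hy, hσ⟩ := h
  refine ⟨fun k => |y k|, ?_⟩
  have key := eq_recSol_of_rec (ε := ε) (s := s) (v := fun k => |y k|) (n := n)
    (a := fun t => |y t|) (fun k => rfl) ?_
  · intro i
    rw [key i i.isLt]
    refine ⟨abs_nonneg _, ?_⟩
    rw [abs_eq_zero, ← hσ i, sign_eq_zero_iff]
  · intro j hj
    have h1 := hy j hj
    have h2 : s j * |y j| = y j := by
      have h3 := hσ ⟨j, by omega⟩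
      by_cases h0 : y j = 0
      · simp [h0]
      · rw [hs.2 ⟨j, by omega⟩ (by rw [← h3]; simpa using h0), ← h3]
        exact sign_mul_abs _
    rw [mul_assoc, h2]
    linarith

theorem realizable_of_recSol {ε : ℝ} {n : ℕ} {σ : Fin n → SignType} {s : ℕ → ℝ} (hs : Fills s σ)
    {v : Fin 4 → ℝ} (hv : ∀ i : Fin n, σ i ≠ 0 → 0 < recSol ε s v i)
    (hv0 : ∀ i : Fin n, σ i = 0 → recSol ε s v i = 0) : Realizable ε n σ := by
  have habs : ∀ i < n, |s i * recSol ε s v i| = recSol ε s v i := by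
    intro i hi
    have h1 : |s i| = 1 := by rcases mem_signSeq.1 hs.1 i with h | h <;> rw [h] <;> simp
    rw [abs_mul, h1, one_mul]
    by_cases h : σ ⟨i, hi⟩ = 0
    · have : recSol ε s v i = 0 := hv0 ⟨i, hi⟩ h
      rw [this, abs_zero]
    · exact abs_of_pos (hv ⟨i, hi⟩ h)
  refine ⟨fun i => s i * recSol ε s v i, fun j hj => ?_, fun i => ?_⟩
  · rw [habs _ (by omega), habs _ (by omega), habs _ (by omega), habs _ hj, recSol]
    ring
  · change SignType.sign (s i * recSol ε s v i) = σ i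
    by_cases h : σ i = 0
    · rw [hv0 i h, h]; simp
    · rw [sign_mul, sign_pos (hv i h), mul_one, hs.2 i h]
      cases hσ : σ i <;> simp_all

/-- The solution with limit `(t - z)^2` need not vanish at `z` for `ε ≠ 0`. Subtracting the right
multiple of the solution with limit `1` restores the exact zero. -/
theorem eventually_realizable (n : ℕ) : ∀ᶠ ε in 𝓝 (0 : ℝ), ∀ σ : Fin n → SignType,
    (Finset.univ.filter fun i => σ i = 0).card ≤ 1 → Realizable ε n σ := by
  filter_upwards [eventually_recSol_pos n, eventually_recSol_pos_of_zero n] with ε h1 h0 σ hσ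
  obtain ⟨s, hs⟩ := exists_fills σ
  rcases Nat.eq_zero_or_pos n with rfl | hn
  · exact ⟨0, fun j hj => by omega, fun i => i.elim0⟩
  by_cases hz : ∃ z : Fin n, (z : ℕ) = 0 ∧ σ z = 0
  · obtain ⟨z, hz0, hz⟩ := hz
    have huniq : ∀ i : Fin n, σ i = 0 → i = z := fun i hi =>
      Finset.card_le_one.1 hσ _ (by simpa using hi) _ (by simpa using hz)
    refine realizable_of_recSol hs (v := ![0, 1, 1, 1]) (fun i hi => ?_) fun i hi => ?_
    · refine h0 i (Nat.pos_of_ne_zero fun h => hi ?_) s hs.1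
      rw [show i = z from Fin.ext (h.trans hz0.symm)]; exact hz
    · rw [huniq i hi, hz0]; simp [recSol]
  · push Not at hz
    obtain ⟨z, hzpos, hzσ⟩ : ∃ z : Fin (n + 1), 0 < (z : ℕ) ∧
        ∀ i : Fin n, σ i = 0 ↔ (i : ℕ) = z := by
      by_cases hex : ∃ z, σ z = 0
      · obtain ⟨z, hz'⟩ := hex
        refine ⟨z.castSucc, Nat.pos_of_ne_zero fun h => hz z h hz', fun i => ⟨fun hi => ?_,
          fun hi => ?_⟩⟩
        · exact congrArg Fin.val
            (Finset.card_le_one.1 hσ i (by simpa using hi) z (by simpa using hz'))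
        · rw [show i = z from Fin.ext hi]; exact hz'
      · push Not at hex
        -- Without zeros the double root is placed at `n`, outside the index range; this is why `z`
        -- ranges over `Fin (n + 1)`.
        exact ⟨Fin.last n, hn, fun i => ⟨fun hi => absurd hi (hex i), fun hi =>
          absurd hi (by simpa using i.isLt.ne)⟩⟩
    set u : Fin 4 → ℝ := ![1, (1 - (z : ℝ)) ^ 2, (2 - (z : ℝ)) ^ 2, (3 - (z : ℝ)) ^ 2] with hu
    have hval : ∀ t, recSol ε s (recSol ε s ![0, 1, 1, 1] z • u
        - recSol ε s u z • ![0, 1, 1, 1]) t = recSol ε s ![0, 1, 1, 1] z * recSol ε s u t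
        - recSol ε s u z * recSol ε s ![0, 1, 1, 1] t := fun t => by
      rw [recSol_sub, recSol_smul, recSol_smul]
    refine realizable_of_recSol hs (v := recSol ε s ![0, 1, 1, 1] z • u
      - recSol ε s u z • ![0, 1, 1, 1]) (fun i hi => ?_) fun i hi => ?_
    · rw [hval]
      exact h1 z hzpos i (fun h => hi ((hzσ i).2 h)) s hs.1
    · rw [hval, (hzσ i).1 hi]; ring

/-! ### Combinatorics of sign vectors -/

/-- `σ` has the same signs as `τ` wherever `τ` is nonzero. -/
def Conforms {ι : Type*} (τ σ : ι → SignType) : Prop := ∀ i, τ i ≠ 0 → σ i = τ i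

theorem mem_one_neg_one {s : SignType} : s ∈ ({1, -1} : Finset SignType) ↔ s ≠ 0 := by
  cases s <;> decide

theorem Conforms.refl {ι : Type*} (σ : ι → SignType) : Conforms σ σ := fun _ _ => rfl

theorem Conforms.trans {ι : Type*} {ρ τ σ : ι → SignType} (h : Conforms ρ τ) (h' : Conforms τ σ) :
    Conforms ρ σ := fun i hi => by
  have h1 := h i hi
  rw [h' i (by rwa [h1]), h1]

theorem Conforms.antisymm {ι : Type*} {τ σ : ι → SignType} (h : Conforms τ σ) (h' : Conforms σ τ) :
    τ = σ := by
  funext i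
  by_cases hi : τ i = 0
  · by_cases hi' : σ i = 0
    · rw [hi, hi']
    · exact h' i hi'
  · exact (h i hi).symm

theorem conforms_update_zero {ι : Type*} [DecidableEq ι] (σ : ι → SignType) (i : ι) :
    Conforms (Function.update σ i 0) σ := fun j hj => by
  by_cases h : j = i
  · subst h; simp at hj
  · rw [Function.update_of_ne h]

/-- The positions of the zeros. -/
def zeroSet {ι : Type*} [Fintype ι] (σ : ι → SignType) : Finset ι :=
  Finset.univ.filter fun i => σ i = 0

theorem mem_zeroSet {ι : Type*} [Fintype ι] {σ : ι → SignType} {i : ι} :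
    i ∈ zeroSet σ ↔ σ i = 0 := by simp [zeroSet]

theorem Conforms.ne_zero {ι : Type*} {τ σ : ι → SignType} (h : Conforms τ σ) (hτ : τ ≠ 0) :
    σ ≠ 0 := by
  rintro rfl
  exact hτ (funext fun i => by_contra fun hi => hi (h i hi).symm)

theorem Conforms.zeroSet_subset {ι : Type*} [Fintype ι] {τ σ : ι → SignType} (h : Conforms τ σ) :
    zeroSet σ ⊆ zeroSet τ := fun i hi => by
  rw [mem_zeroSet] at *
  by_contra h0
  exact h0 ((h i h0).symm.trans hi)

theorem zeroSet_update_zero {ι : Type*} [Fintype ι] [DecidableEq ι] (σ : ι → SignType) (i : ι) :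
    zeroSet (Function.update σ i 0) = insert i (zeroSet σ) := by
  ext j
  rw [Finset.mem_insert, mem_zeroSet, mem_zeroSet]
  by_cases h : j = i
  · subst h; simp
  · rw [Function.update_of_ne h]; simp [h]

/-- Incidences between faces of consecutive dimensions are thus single-entry changes, which is how
they are counted later. -/
theorem conforms_and_card_iff {ι : Type*} [Fintype ι] [DecidableEq ι] {τ σ : ι → SignType} :
    (Conforms τ σ ∧ (zeroSet τ).card = (zeroSet σ).card + 1) ↔
      ∃ i, σ i ≠ 0 ∧ τ = Function.update σ i 0 := by
  constructor
  · rintro ⟨h, hc⟩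
    have h1 : (zeroSet τ \ zeroSet σ).card = 1 := by
      rw [Finset.card_sdiff_of_subset h.zeroSet_subset]; omega
    obtain ⟨i, hi⟩ := Finset.card_eq_one.1 h1
    have hmem : ∀ j, (τ j = 0 ∧ σ j ≠ 0) ↔ j = i := fun j => by
      rw [show j = i ↔ j ∈ ({i} : Finset ι) from Finset.mem_singleton.symm, ← hi, Finset.mem_sdiff, mem_zeroSet, mem_zeroSet]
    refine ⟨i, ((hmem i).2 rfl).2, funext fun j => ?_⟩
    by_cases hj : j = i
    · subst hj; simpa using ((hmem j).2 rfl).1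
    · rw [Function.update_of_ne hj]
      by_cases h0 : τ j = 0
      · by_contra hne
        exact hj ((hmem j).1 ⟨h0, fun h' => hne (h0.trans h'.symm)⟩)
      · exact (h j h0).symm
  · rintro ⟨i, hi, rfl⟩
    refine ⟨conforms_update_zero σ i, ?_⟩
    rw [zeroSet_update_zero, Finset.card_insert_of_notMem (by rwa [mem_zeroSet])]

theorem prod_neg_one_eq_pow_card_zeroSet {ι : Type*} [Fintype ι] (σ : ι → SignType) :
    ∏ i, (if σ i = 0 then (-1 : ℤ) else 1) = (-1) ^ (zeroSet σ).card := by
  rw [Finset.prod_ite]; simp [zeroSet]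

/-- The number of sign vectors without zeros that conform to a given one. -/
theorem card_full_conforms {ι : Type*} [Fintype ι] [DecidableEq ι] (τ : ι → SignType)
    [DecidablePred fun σ : ι → SignType => Conforms τ σ ∧ ∀ i, σ i ≠ 0] :
    (Finset.univ.filter fun σ : ι → SignType => Conforms τ σ ∧ ∀ i, σ i ≠ 0).card
      = 2 ^ (zeroSet τ).card := by
  have h : (Finset.univ.filter fun σ : ι → SignType => Conforms τ σ ∧ ∀ i, σ i ≠ 0)
      = Fintype.piFinset fun i => if τ i = 0 then {1, -1} else {τ i} := by
    ext σ
    rw [Finset.mem_filter, Fintype.mem_piFinset]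
    constructor
    · rintro ⟨_, h, h'⟩ i
      split_ifs with h0
      · have := h' i
        revert this
        cases σ i <;> decide
      · simpa using h i h0
    · intro h
      refine ⟨Finset.mem_univ _, fun i hi => ?_, fun i => ?_⟩
      · have := h i; rw [if_neg hi] at this; simpa using this
      · have := h i
        split_ifs at this with h0
        · revert this
          cases σ i <;> decide
        · rw [Finset.mem_singleton.1 this]; exact h0
  rw [h, Fintype.card_piFinset]
  have : ∀ i, (if τ i = 0 then ({1, -1} : Finset SignType) else {τ i}).card
      = if τ i = 0 then 2 else 1 := fun i => by split_ifs <;> simp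
  simp only [this]
  rw [Finset.prod_ite]; simp [zeroSet]

theorem card_one_zero (n : ℕ) :
    (Finset.univ.filter fun σ : Fin n → SignType => (zeroSet σ).card = 1).card
      = n * 2 ^ (n - 1) := by
  have h : (Finset.univ.filter fun σ : Fin n → SignType => (zeroSet σ).card = 1)
      = Finset.univ.biUnion fun i : Fin n =>
        Fintype.piFinset fun j => if j = i then {0} else {1, -1} := by
    ext σ
    simp only [Finset.mem_filter, Finset.mem_univ, true_and, Finset.mem_biUnion,
      Fintype.mem_piFinset, Finset.card_eq_one]
    refine exists_congr fun i => ?_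
    rw [Finset.ext_iff]
    refine forall_congr' fun j => ?_
    rw [mem_zeroSet, Finset.mem_singleton]
    by_cases hj : j = i
    · simp [hj]
    · simp only [hj, iff_false, if_false]
      cases σ j <;> decide
  rw [h, Finset.card_biUnion]
  · have : ∀ i : Fin n, (Fintype.piFinset fun j : Fin n =>
        if j = i then ({0} : Finset SignType) else {1, -1}).card = 2 ^ (n - 1) := by
      intro i
      rw [Fintype.card_piFinset]
      have : ∀ j, (if j = i then ({0} : Finset SignType) else {1, -1}).card
        = if j = i then 1 else 2 := fun j => by split_ifs <;> simp
      simp only [this]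
      rw [Finset.prod_ite]
      simp [Finset.filter_ne', Finset.card_erase_of_mem]
    simp [this]
  · intro i _ j _ hij
    refine Finset.disjoint_left.2 fun σ h1 h2 => ?_
    have h3 := Fintype.mem_piFinset.1 h1 i
    have h4 := Fintype.mem_piFinset.1 h2 i
    rw [if_pos rfl, Finset.mem_singleton] at h3
    rw [if_neg hij, h3] at h4
    simp at h4

/-! ### Counting the cells of the sign fan -/

section Realizable

variable {ε : ℝ} {n : ℕ}

/-- The positions of the zeros, as natural numbers. -/
def zeroIdx (σ : Fin n → SignType) : Finset ℕ := (zeroSet σ).map Fin.valEmbedding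

theorem card_zeroIdx (σ : Fin n → SignType) : (zeroIdx σ).card = (zeroSet σ).card :=
  Finset.card_map _

theorem zeroIdx_subset (σ : Fin n → SignType) : zeroIdx σ ⊆ Finset.range n := fun i hi => by
  obtain ⟨j, _, rfl⟩ := Finset.mem_map.1 hi
  simp

theorem forall_mem_zeroIdx {σ : Fin n → SignType} {p : ℕ → Prop} :
    (∀ i ∈ zeroIdx σ, p i) ↔ ∀ i : Fin n, σ i = 0 → p i := by
  simp [zeroIdx, mem_zeroSet]

theorem val_mem_zeroIdx {σ : Fin n → SignType} {i : Fin n} : (i : ℕ) ∈ zeroIdx σ ↔ σ i = 0 := by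
  simp [zeroIdx, mem_zeroSet, Fin.val_inj]

theorem Fills.of_conforms {s : ℕ → ℝ} {τ σ : Fin n → SignType} (h : Fills s σ)
    (hc : Conforms τ σ) : Fills s τ :=
  ⟨h.1, fun i hi => by
    have := hc i hi
    rw [h.2 i (by rwa [this]), this]⟩

theorem Realizable.card_zeroSet_le {σ : Fin n → SignType} (h : Realizable ε n σ)
    (hG : GeneralPosition ε n) (h0 : σ ≠ 0) : (zeroSet σ).card ≤ 3 := by
  by_contra hc
  obtain ⟨s, hs⟩ := exists_fills σ
  obtain ⟨v, hv⟩ := h.exists_recSol hs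
  have : v = 0 := hG s hs.1 v (zeroIdx σ) (zeroIdx_subset σ) (by rw [card_zeroIdx]; omega)
    (forall_mem_zeroIdx.2 fun i hi => (hv i).2.2 hi)
  refine h0 (funext fun i => (hv i).2.1 ?_)
  rw [this, recSol_zero]

/-- Every face of a surviving proper face survives. A small multiple of a solution that is positive
at the zeros to be removed and vanishes at those to be kept is added; it exists because `τ` has at
most three zeros. -/
theorem Realizable.of_conforms {τ σ : Fin n → SignType} (h : Realizable ε n τ)
    (hG : GeneralPosition ε n) (hn : 4 ≤ n) (h0 : τ ≠ 0) (hc : Conforms τ σ) :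
    Realizable ε n σ := by
  obtain ⟨s, hs⟩ := exists_fills σ
  obtain ⟨v, hv⟩ := h.exists_recSol (hs.of_conforms hc)
  have hle := h.card_zeroSet_le hG h0
  obtain ⟨w, hw⟩ := hG.exists_eq hn hs.1 (zeroIdx_subset τ) (by rw [card_zeroIdx]; omega)
    fun i => if h : i < n then (if σ ⟨i, h⟩ = 0 then 0 else 1) else 0
  rw [forall_mem_zeroIdx] at hw
  have hev : ∀ᶠ δ in 𝓝 (0 : ℝ), ∀ i : Fin n, τ i ≠ 0 →
      0 < recSol ε s v i + δ * recSol ε s w i := by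
    simp only [eventually_all]
    intro i hi
    have hpos : 0 < recSol ε s v i :=
      lt_of_le_of_ne (hv i).1 fun h => hi ((hv i).2.1 h.symm)
    have hcont : ContinuousAt (fun δ : ℝ => recSol ε s v i + δ * recSol ε s w i) 0 := by fun_prop
    exact hcont.eventually_const_lt (by simpa using hpos)
  obtain ⟨δ, hδ, hδpos⟩ :=
    ((hev.filter_mono nhdsWithin_le_nhds).and (self_mem_nhdsWithin (s := Set.Ioi (0 : ℝ)))).exists
  refine realizable_of_recSol hs (v := v + δ • w) (fun i hi => ?_) fun i hi => ?_
  · rw [recSol_add, recSol_smul]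
    by_cases hτ : τ i = 0
    · rw [(hv i).2.2 hτ, hw i hτ]
      simpa [hi] using hδpos
    · exact hδ i hτ
  · have hτ : τ i = 0 := by
      by_contra h'
      exact h' ((hc i h').symm.trans hi)
    rw [recSol_add, recSol_smul, (hv i).2.2 hτ, hw i hτ]
    simp [hi]

theorem Realizable.tail {σ : Fin (n + 1) → SignType} (h : Realizable ε (n + 1) σ) :
    Realizable ε n (Fin.tail σ) := by
  obtain ⟨y, hy, hσ⟩ := h
  refine ⟨fun i => y (i + 1), fun j hj => ?_, fun i => ?_⟩
  · have := hy (j + 1) (by omega)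
    convert this using 1
  · exact hσ i.succ

/-- The equation with `j = 0` can be solved for the new leading entry because its coefficient is
`ε`. -/
theorem Realizable.exists_cons {τ : Fin n → SignType} (hε : ε ≠ 0) (h : Realizable ε n τ) :
    ∃ s, Realizable ε (n + 1) (Fin.cons s τ : Fin (n + 1) → SignType) := by
  obtain ⟨y, hy, hσ⟩ := h
  refine ⟨SignType.sign (-(|y 0| - 3 * |y 1| + 3 * |y 2| - |y 3|) / ε),
    fun i => i.casesOn (-(|y 0| - 3 * |y 1| + 3 * |y 2| - |y 3|) / ε) y,
    fun j hj => ?_, fun i => ?_⟩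
  · cases j with
    | zero =>
      change ε * (-(|y 0| - 3 * |y 1| + 3 * |y 2| - |y 3|) / ε)
        + (|y 0| - 3 * |y 1| + 3 * |y 2| - |y 3|) = 0
      field_simp
      ring
    | succ j => exact hy j (by omega)
  · refine Fin.cases ?_ (fun i => ?_) i
    · simp
    · simpa using hσ i

theorem Realizable.tail_ne_zero {σ : Fin (n + 1) → SignType} (hε : ε ≠ 0) (hn : 4 ≤ n)
    (h : Realizable ε (n + 1) σ) (h0 : σ ≠ 0) : Fin.tail σ ≠ 0 := by
  intro ht
  obtain ⟨y, hy, hσ⟩ := h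
  have hz : ∀ i : ℕ, 0 < i → i < n + 1 → y i = 0 := by
    intro i hi hin
    have h1 := hσ ⟨i, hin⟩
    have h2 : σ ⟨i, hin⟩ = 0 := by
      have := congrFun ht ⟨i - 1, by omega⟩
      simp only [Fin.tail, Pi.zero_apply] at this
      rw [← this]; congr 1; ext; simp; omega
    rwa [h2, sign_eq_zero_iff] at h1
  have h3 := hy 0 (by omega)
  simp only [zero_add] at h3
  rw [hz 1 (by omega) (by omega), hz 2 (by omega) (by omega), hz 3 (by omega) (by omega),
    hz 4 (by omega) (by omega)] at h3
  have h4 : y 0 = 0 := by simpa [hε] using h3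
  refine h0 (funext fun i => ?_)
  rw [← hσ i]
  rcases Nat.eq_zero_or_pos (i : ℕ) with hi | hi
  · rw [hi, h4]; simp
  · rw [hz i hi i.isLt]; simp

/-- A sign cell is convex and the absolute values are linear on it, so the leading entry takes the
value zero between its two signs. -/
theorem Realizable.cons_zero {τ : Fin n → SignType}
    (hp : Realizable ε (n + 1) (Fin.cons 1 τ : Fin (n + 1) → SignType))
    (hm : Realizable ε (n + 1) (Fin.cons (-1) τ : Fin (n + 1) → SignType)) :
    Realizable ε (n + 1) (Fin.cons 0 τ : Fin (n + 1) → SignType) := by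
  obtain ⟨y, hy, hσ⟩ := hp
  obtain ⟨y', hy', hσ'⟩ := hm
  have h0 : 0 < y 0 := sign_eq_one_iff.1 (by simpa using hσ 0)
  have h0' : y' 0 < 0 := sign_eq_neg_one_iff.1 (by simpa using hσ' 0)
  -- The two positive weights are chosen so that the entries at `0` cancel.
  set l := -y' 0 with hl
  set m := y 0 with hm
  have hlpos : 0 < l := by linarith
  have htail : ∀ i, 0 < i → i < n + 1 → SignType.sign (l * y i + m * y' i) = SignType.sign (y i) ∧
      |l * y i + m * y' i| = l * |y i| + m * |y' i| := by
    intro i hi hin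
    obtain ⟨k, rfl⟩ : ∃ k, i = k + 1 := ⟨i - 1, by omega⟩
    have e1 := hσ (Fin.succ ⟨k, by omega⟩)
    have e2 := hσ' (Fin.succ ⟨k, by omega⟩)
    simp only [Fin.val_succ, Fin.cons_succ] at e1 e2
    rcases lt_trichotomy (y (k + 1)) 0 with h | h | h
    · have h' : y' (k + 1) < 0 := by
        rw [← sign_eq_neg_one_iff, e2, ← e1, sign_eq_neg_one_iff]; exact h
      have h1 := mul_neg_of_pos_of_neg hlpos h
      have h2 := mul_neg_of_pos_of_neg h0 h'
      rw [abs_of_neg h, abs_of_neg h', abs_of_neg (by linarith), sign_neg h,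
        sign_neg (by linarith)]
      exact ⟨rfl, by ring⟩
    · have h' : y' (k + 1) = 0 := by
        rw [← sign_eq_zero_iff, e2, ← e1, sign_eq_zero_iff]; exact h
      rw [h, h']; simp
    · have h' : 0 < y' (k + 1) := by
        rw [← sign_eq_one_iff, e2, ← e1, sign_eq_one_iff]; exact h
      have h1 := mul_pos hlpos h
      have h2 := mul_pos h0 h'
      rw [abs_of_pos h, abs_of_pos h', abs_of_pos (by linarith), sign_pos h,
        sign_pos (by linarith)]
      exact ⟨rfl, rfl⟩
  refine ⟨fun i => l * y i + m * y' i, fun j hj => ?_, fun i => ?_⟩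
  · rw [(htail _ (by omega) (by omega)).2, (htail _ (by omega) (by omega)).2,
      (htail _ (by omega) (by omega)).2, (htail _ (by omega) hj).2]
    linear_combination l * hy j hj + m * hy' j hj
  · refine Fin.cases ?_ (fun i => ?_) i
    · change SignType.sign (l * y 0 + m * y' 0) = 0
      rw [sign_eq_zero_iff, hl, hm]; ring
    · rw [Fin.cons_succ, (htail _ (by simp) (i.succ).isLt).1]
      simpa using hσ i.succ

open Classical in
/-- Each cell of the sign fan is either contained in an open half-space of the next coordinate or
is cut into three cells. -/
theorem sum_cons_eq_one (hε : ε ≠ 0) (hG : GeneralPosition ε (n + 1)) (hn : 4 ≤ n)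
    {τ : Fin n → SignType} (h : Realizable ε n τ) (h0 : τ ≠ 0) :
    ∑ s : SignType, (if Realizable ε (n + 1) (Fin.cons s τ : Fin (n + 1) → SignType) then
      (if s = 0 then (-1 : ℤ) else 1) else 0) = 1 := by
  -- General position excludes a cell lying entirely in the hyperplane: if the sign `0` occurs, so
  -- do both others. The fibre then contributes `1 - 1 + 1`, and otherwise a single `1`.
  have hsplit : ∀ s, Realizable ε (n + 1) (Fin.cons 0 τ : Fin (n + 1) → SignType) →
      Realizable ε (n + 1) (Fin.cons s τ : Fin (n + 1) → SignType) := fun s hz => by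
    refine hz.of_conforms hG (by omega) ?_ fun i => ?_
    · intro h'
      exact h0 (funext fun i => by simpa using congrFun h' i.succ)
    · refine Fin.cases (fun h => absurd rfl h) (fun i _ => ?_) i
      simp
  have huniv : (Finset.univ : Finset SignType) = {0, -1, 1} := rfl
  rw [huniv, Finset.sum_insert (by decide), Finset.sum_insert (by decide), Finset.sum_singleton]
  have hpm := Realizable.cons_zero (ε := ε) (τ := τ)
  obtain ⟨s, hs⟩ := h.exists_cons hε
  have h1 := hsplit 1
  have h2 := hsplit (-1)
  by_cases hz : Realizable ε (n + 1) (Fin.cons 0 τ : Fin (n + 1) → SignType)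
  · simp [hz, h1 hz, h2 hz]
  · by_cases hp : Realizable ε (n + 1) (Fin.cons 1 τ : Fin (n + 1) → SignType)
    · have hm : ¬ Realizable ε (n + 1) (Fin.cons (-1) τ : Fin (n + 1) → SignType) :=
        fun hm => hz (hpm hp hm)
      simp [hz, hp, hm]
    · have hm : Realizable ε (n + 1) (Fin.cons (-1) τ : Fin (n + 1) → SignType) := by
        cases s
        · exact absurd hs hz
        · exact hs
        · exact absurd hs hp
      simp [hz, hp, hm]

open Classical in
/-- The realizable sign vectors, without the zero vector. -/
noncomputable def realizableSet (ε : ℝ) (n : ℕ) : Finset (Fin n → SignType) :=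
  Finset.univ.filter fun σ => Realizable ε n σ ∧ σ ≠ 0

theorem mem_realizableSet {σ : Fin n → SignType} :
    σ ∈ realizableSet ε n ↔ Realizable ε n σ ∧ σ ≠ 0 := by simp [realizableSet]

/-- For `n = 4` there are no equations, so all sign vectors occur. The full sum is `(1 + 1 - 1)^4 =
1`, and the zero vector accounts for all of it. -/
theorem sum_four_eq_zero (ε : ℝ) :
    ∑ σ ∈ realizableSet ε 4, ∏ i, (if σ i = 0 then (-1 : ℤ) else 1) = 0 := by
  have h1 : realizableSet ε 4 = Finset.univ.erase 0 := by
    ext σ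
    simp only [mem_realizableSet, Finset.mem_erase, Finset.mem_univ, and_true, and_iff_right_iff_imp]
    intro _
    refine ⟨fun i => if h : i < 4 then (σ ⟨i, h⟩ : ℝ) else 0, fun j hj => by omega, fun i => ?_⟩
    simp only [i.isLt, dite_true, Fin.eta]
    cases σ i <;> simp
  have h2 := Finset.add_sum_erase (Finset.univ : Finset (Fin 4 → SignType))
    (fun σ => ∏ i, (if σ i = 0 then (-1 : ℤ) else 1)) (Finset.mem_univ 0)
  rw [← h1, ← Fintype.sum_pow (fun s : SignType => if s = 0 then (-1 : ℤ) else 1) 4] at h2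
  have h3 : ∑ s : SignType, (if s = 0 then (-1 : ℤ) else 1) = 1 := by decide
  rw [h3] at h2
  simpa using h2

/-- Induction on `n` by adding a leading coordinate: this refines the fan by one piecewise linear
hypersurface and leaves the alternating count over each old cell unchanged. -/
theorem euler_sum (hε : ε ≠ 0) (hn : 4 ≤ n) (hG : GeneralPosition ε n) :
    ∑ σ ∈ realizableSet ε n, ∏ i, (if σ i = 0 then (-1 : ℤ) else 1) = 0 := by
  classical
  induction n, hn using Nat.le_induction with
  | base => exact sum_four_eq_zero ε
  | succ n hn ih =>
    rw [← ih (hG.mono (Nat.le_succ n))]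
    rw [realizableSet, realizableSet, Finset.sum_filter, Finset.sum_filter,
      ← (Fin.consEquiv fun _ : Fin (n + 1) => SignType).sum_comp, Fintype.sum_prod_type_right]
    refine Finset.sum_congr rfl fun τ _ => ?_
    split_ifs with h
    · refine Eq.trans ?_ ((congrArg (_ * ·) (sum_cons_eq_one hε hG hn h.1 h.2)).trans (mul_one _))
      rw [Finset.mul_sum]
      refine Finset.sum_congr rfl fun s _ => ?_
      have hne : (Fin.cons s τ : Fin (n + 1) → SignType) ≠ 0 := fun h' =>
        h.2 (funext fun i => by simpa using congrFun h' i.succ)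
      simp only [Fin.consEquiv, Equiv.coe_fn_mk, hne, ne_eq, not_false_eq_true, and_true,
        Fin.prod_univ_succ, Fin.cons_zero, Fin.cons_succ]
      split_ifs <;> simp
    · refine Finset.sum_eq_zero fun s _ => if_neg ?_
      rintro ⟨h1, h2⟩
      have h3 := h1.tail_ne_zero hε hn h2
      have h4 := h1.tail
      simp only [Fin.consEquiv, Equiv.coe_fn_mk, Fin.tail_cons] at h3 h4
      exact h ⟨h4, h3⟩

/-- The number of realizable sign vectors with `k` zeros. -/
noncomputable def realizableCount (ε : ℝ) (n k : ℕ) : ℕ :=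
  ((realizableSet ε n).filter fun σ => (zeroSet σ).card = k).card

theorem euler_relation (hε : ε ≠ 0) (hn : 4 ≤ n) (hG : GeneralPosition ε n) :
    (realizableCount ε n 0 : ℤ) - realizableCount ε n 1 + realizableCount ε n 2
      - realizableCount ε n 3 = 0 := by
  rw [← euler_sum hε hn hG]
  simp only [realizableCount, Finset.card_filter, Nat.cast_sum]
  rw [← Finset.sum_sub_distrib, ← Finset.sum_add_distrib, ← Finset.sum_sub_distrib]
  refine Finset.sum_congr rfl fun σ hσ => ?_
  rw [mem_realizableSet] at hσ
  have := hσ.1.card_zeroSet_le hG hσ.2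
  rw [prod_neg_one_eq_pow_card_zeroSet]
  generalize (zeroSet σ).card = k at *
  interval_cases k <;> simp

/-- A two-dimensional cell of the sign fan has exactly two rays. -/
theorem Realizable.card_rays {σ : Fin n → SignType} (h : Realizable ε n σ)
    (hG : GeneralPosition ε n) (hn : 4 ≤ n) (h2 : (zeroSet σ).card = 2)
    [DecidablePred fun i => σ i ≠ 0 ∧ Realizable ε n (Function.update σ i 0)] :
    (Finset.univ.filter fun i => σ i ≠ 0 ∧ Realizable ε n (Function.update σ i 0)).card = 2 := by
  classical
  obtain ⟨s, hs⟩ := exists_fills σ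
  obtain ⟨v, hv⟩ := h.exists_recSol hs
  have hA : ∀ i : Fin n, σ i ≠ 0 → 0 < recSol ε s v i := fun i hi =>
    lt_of_le_of_ne (hv i).1 fun h => hi ((hv i).2.1 h.symm)
  set I : Finset (Fin n) := Finset.univ.filter fun i => σ i ≠ 0 with hI
  have hmemI : ∀ i, i ∈ I ↔ σ i ≠ 0 := fun i => by simp [hI]
  have hIcard : 1 < I.card := by
    have h3 := Finset.card_filter_add_card_filter_not (s := (Finset.univ : Finset (Fin n)))
      (fun i => σ i = 0)
    rw [Finset.card_univ, Fintype.card_fin] at h3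
    change (zeroSet σ).card + I.card = n at h3
    omega
  obtain ⟨p, hp, q, hq, hpq⟩ := Finset.one_lt_card.1 hIcard
  rw [hmemI] at hp hq
  have hins : ∀ i j : Fin n, i ≠ j → σ i ≠ 0 → σ j ≠ 0 →
      (insert (i : ℕ) (insert (j : ℕ) (zeroIdx σ))).card = 4 ∧
        insert (i : ℕ) (insert (j : ℕ) (zeroIdx σ)) ⊆ Finset.range n := by
    intro i j hij hi hj
    constructor
    · rw [Finset.card_insert_of_notMem, Finset.card_insert_of_notMem, card_zeroIdx, h2]
      · rwa [val_mem_zeroIdx]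
      · rw [Finset.mem_insert, val_mem_zeroIdx]
        rintro (h | h)
        · exact hij (Fin.ext h)
        · exact hi h
    · refine Finset.insert_subset (by simp) (Finset.insert_subset (by simp) (zeroIdx_subset σ))
  have hfour : ∀ u : Fin 4 → ℝ, (∀ z : Fin n, σ z = 0 → recSol ε s u z = 0) → ∀ i j : Fin n,
      i ≠ j → σ i ≠ 0 → σ j ≠ 0 → recSol ε s u i = 0 → recSol ε s u j = 0 → u = 0 := by
    intro u hu i j hij hi hj hui huj
    obtain ⟨h3, h4⟩ := hins i j hij hi hj
    refine hG s hs.1 u _ h4 h3.ge ?_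
    rw [Finset.forall_mem_insert, Finset.forall_mem_insert, forall_mem_zeroIdx]
    exact ⟨hui, huj, hu⟩
  -- `v` and `w` span the plane of solutions that vanish at the zeros of `σ`: `w` is `0` at `p` and
  -- `1` at `q`, while `v` is positive at both.
  obtain ⟨w, hw⟩ := hG.exists_eq hn hs.1 (hins p q hpq hp hq).2 (hins p q hpq hp hq).1.le
    fun i => if i = q then 1 else 0
  rw [Finset.forall_mem_insert, Finset.forall_mem_insert, forall_mem_zeroIdx] at hw
  obtain ⟨hwp, hwq, hwz⟩ := hw
  rw [if_neg (fun h => hpq (Fin.ext h))] at hwp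
  rw [if_pos rfl] at hwq
  have hwz' : ∀ z : Fin n, σ z = 0 → recSol ε s w z = 0 := fun z hz => by
    rw [hwz z hz, if_neg]
    intro h'
    exact hq (by rw [← Fin.ext h']; exact hz)
  -- The solution `w - r i • v` vanishes at `i`, and its sign at `j` is that of `r j - r i`. By
  -- general position the ratios at nonzero positions are distinct, so the two rays belong to the
  -- least and the greatest ratio.
  set r : Fin n → ℝ := fun i => recSol ε s w i / recSol ε s v i with hr
  have hu : ∀ i j : Fin n, σ j ≠ 0 →
      recSol ε s (w - r i • v) j = recSol ε s v j * (r j - r i) := by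
    intro i j hj
    rw [recSol_sub, recSol_smul, mul_sub, hr]
    have := (hA j hj).ne'
    field_simp
  have huz : ∀ i z : Fin n, σ z = 0 → recSol ε s (w - r i • v) z = 0 := fun i z hz => by
    rw [recSol_sub, recSol_smul, hwz' z hz, (hv z).2.2 hz]; simp
  have hinj : ∀ i j : Fin n, σ i ≠ 0 → σ j ≠ 0 → r i = r j → i = j := by
    intro i j hi hj hij
    by_contra hne
    have h0 := hfour (w - r i • v) (huz i) i j hne hi hj (by rw [hu i i hi]; ring)
      (by rw [hu i j hj, hij]; ring)
    have e1 := hu i p hp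
    have e2 := hu i q hq
    rw [h0, recSol_zero] at e1 e2
    have e3 := sub_eq_zero.1 ((mul_eq_zero.1 e1.symm).resolve_left (hA p hp).ne')
    have e4 := sub_eq_zero.1 ((mul_eq_zero.1 e2.symm).resolve_left (hA q hq).ne')
    have e5 : r p = 0 := by simp [hr, hwp]
    have e6 : r q = 1 / recSol ε s v q := by simp [hr, hwq]
    rw [e5] at e3
    rw [e6, ← e3] at e4
    exact (one_div_pos.2 (hA q hq)).ne' e4
  have hIne : I.Nonempty := ⟨p, (hmemI p).2 hp⟩
  obtain ⟨i0, hi0, hmin⟩ := I.exists_min_image r hIne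
  obtain ⟨i1, hi1, hmax⟩ := I.exists_max_image r hIne
  rw [hmemI] at hi0 hi1
  have hfill : ∀ i, Fills s (Function.update σ i 0) := fun i =>
    hs.of_conforms (conforms_update_zero σ i)
  have hupd : ∀ i j, Function.update σ i 0 j ≠ 0 ↔ j ≠ i ∧ σ j ≠ 0 := by
    intro i j
    by_cases hj : j = i
    · subst hj; simp
    · rw [Function.update_of_ne hj]; simp [hj]
  have hreal0 : Realizable ε n (Function.update σ i0 0) := by
    refine realizable_of_recSol (hfill i0) (v := w - r i0 • v) (fun j hj => ?_) fun j hj => ?_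
    · obtain ⟨hj1, hj2⟩ := (hupd _ _).1 hj
      rw [hu i0 j hj2]
      exact mul_pos (hA j hj2) (sub_pos.2 (lt_of_le_of_ne (hmin j ((hmemI j).2 hj2))
        fun h => hj1 (hinj _ _ hj2 hi0 h.symm)))
    · by_cases hj2 : σ j = 0
      · exact huz i0 j hj2
      · by_cases hj1 : j = i0
        · rw [hj1, hu i0 i0 hi0]; ring
        · exact absurd hj ((hupd _ _).2 ⟨hj1, hj2⟩)
  have hreal1 : Realizable ε n (Function.update σ i1 0) := by
    refine realizable_of_recSol (hfill i1) (v := (-1 : ℝ) • (w - r i1 • v)) (fun j hj => ?_)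
      fun j hj => ?_
    · obtain ⟨hj1, hj2⟩ := (hupd _ _).1 hj
      rw [recSol_smul, hu i1 j hj2]
      have := mul_pos (hA j hj2) (sub_pos.2 (lt_of_le_of_ne (hmax j ((hmemI j).2 hj2))
        fun h => hj1 (hinj _ _ hj2 hi1 h)))
      linarith
    · rw [recSol_smul]
      by_cases hj2 : σ j = 0
      · rw [huz i1 j hj2]; ring
      · by_cases hj1 : j = i1
        · rw [hj1, hu i1 i1 hi1]; ring
        · exact absurd hj ((hupd _ _).2 ⟨hj1, hj2⟩)
  have hne : i0 ≠ i1 := by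
    intro h01
    have h3 : ∀ i, σ i ≠ 0 → r i = r i0 := fun i hi =>
      le_antisymm (by rw [h01]; exact hmax i ((hmemI i).2 hi)) (hmin i ((hmemI i).2 hi))
    exact hpq (hinj p q hp hq ((h3 p hp).trans (h3 q hq).symm))
  have hset : (Finset.univ.filter fun i => σ i ≠ 0 ∧ Realizable ε n (Function.update σ i 0))
      = {i0, i1} := by
    ext i
    simp only [Finset.mem_filter, Finset.mem_univ, true_and, Finset.mem_insert,
      Finset.mem_singleton]
    constructor
    · rintro ⟨hi, hreal⟩
      by_contra hcon
      push Not at hcon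
      obtain ⟨b, hb⟩ := hreal.exists_recSol (hfill i)
      have hBpos : ∀ j, j ≠ i → σ j ≠ 0 → 0 < recSol ε s b j := fun j hj1 hj2 =>
        lt_of_le_of_ne (hb j).1 fun h => (hupd i j).2 ⟨hj1, hj2⟩ ((hb j).2.1 h.symm)
      have hB0 : ∀ j, (j = i ∨ σ j = 0) → recSol ε s b j = 0 := fun j hj =>
        (hb j).2.2 (by
          by_contra h'
          have := (hupd i j).1 h'
          tauto)
      set U := recSol ε s (w - r i • v) with hU
      have hU1 : 0 < U i1 := by
        rw [hU, hu i i1 hi1]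
        exact mul_pos (hA _ hi1) (sub_pos.2 (lt_of_le_of_ne (hmax i ((hmemI i).2 hi))
          fun h => hcon.2 (hinj _ _ hi hi1 h)))
      have hU0 : U i0 < 0 := by
        rw [hU, hu i i0 hi0]
        exact mul_neg_of_pos_of_neg (hA _ hi0) (sub_neg.2 (lt_of_le_of_ne
          (hmin i ((hmemI i).2 hi)) fun h => hcon.1 (hinj _ _ hi hi0 h.symm)))
      -- A ray `b` at a non-extremal `i` would be proportional to `U = w - r i • v`, but `b` is
      -- positive at `i0` and `i1` while `U` changes sign between them. The combination is chosen to
      -- vanish at `i` and `i1`.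
      have hx : ∀ t, recSol ε s (U i1 • b - recSol ε s b i1 • (w - r i • v)) t
          = U i1 * recSol ε s b t - recSol ε s b i1 * U t := fun t => by
        rw [recSol_sub, recSol_smul, recSol_smul]
      have hx0 := hfour (U i1 • b - recSol ε s b i1 • (w - r i • v))
        (fun z hz => by rw [hx, hB0 z (Or.inr hz), hU, huz i z hz]; ring) i i1 hcon.2 hi hi1
        (by rw [hx, hB0 i (Or.inl rfl), hU, hu i i hi]; ring) (by rw [hx]; ring)
      have hx1 := hx i0
      rw [hx0, recSol_zero] at hx1
      have h5 := mul_pos hU1 (hBpos i0 (Ne.symm hcon.1) hi0)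
      have h6 := mul_neg_of_pos_of_neg (hBpos i1 (Ne.symm hcon.2) hi1) hU0
      linarith
    · rintro (rfl | rfl)
      · exact ⟨hi0, hreal0⟩
      · exact ⟨hi1, hreal1⟩
  rw [hset, Finset.card_pair hne]

/-- Double count of pairs (2-face, facet): two rays bound each planar cell, and a vector with three
zeros has `3 · 2` ways to sign one of them. -/
theorem two_mul_realizableCount_two (hG : GeneralPosition ε n) (hn : 4 ≤ n) :
    2 * realizableCount ε n 2 = 6 * realizableCount ε n 3 := by
  classical
  have hdc := Finset.sum_card_bipartiteAbove_eq_sum_card_bipartiteBelow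
    (s := (realizableSet ε n).filter fun σ => (zeroSet σ).card = 2)
    (t := (realizableSet ε n).filter fun σ => (zeroSet σ).card = 3)
    (fun σ τ : Fin n → SignType => Conforms τ σ)
  have h1 : ∀ σ ∈ (realizableSet ε n).filter fun σ => (zeroSet σ).card = 2,
      (Finset.bipartiteAbove (fun σ τ : Fin n → SignType => Conforms τ σ)
        ((realizableSet ε n).filter fun σ => (zeroSet σ).card = 3) σ).card = 2 := by
    intro σ hσ
    rw [Finset.mem_filter, mem_realizableSet] at hσ
    obtain ⟨⟨hreal, _⟩, hcard⟩ := hσ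
    rw [← hreal.card_rays hG hn hcard]
    symm
    refine Finset.card_bij (fun i _ => Function.update σ i 0) ?_ ?_ ?_
    · intro i hi
      rw [Finset.mem_filter] at hi
      obtain ⟨hc, hc'⟩ := conforms_and_card_iff.2 ⟨i, hi.2.1, rfl⟩
      simp only [Finset.bipartiteAbove, Finset.mem_filter, mem_realizableSet]
      refine ⟨⟨⟨hi.2.2, fun h => ?_⟩, by omega⟩, hc⟩
      rw [h] at hc'
      simp [zeroSet] at hc' hcard
      omega
    · intro i hi j hj hij
      rw [Finset.mem_filter] at hi hj
      by_contra hne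
      have := congrFun hij i
      rw [Function.update_self, Function.update_of_ne hne] at this
      exact hi.2.1 this.symm
    · intro τ hτ
      simp only [Finset.bipartiteAbove, Finset.mem_filter, mem_realizableSet] at hτ
      obtain ⟨i, hi, rfl⟩ := conforms_and_card_iff.1 ⟨hτ.2, by omega⟩
      exact ⟨i, by simpa [hi] using hτ.1.1.1, rfl⟩
  have h2 : ∀ τ ∈ (realizableSet ε n).filter fun σ => (zeroSet σ).card = 3,
      (Finset.bipartiteBelow (fun σ τ : Fin n → SignType => Conforms τ σ)
        ((realizableSet ε n).filter fun σ => (zeroSet σ).card = 2) τ).card = 6 := by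
    intro τ hτ
    rw [Finset.mem_filter, mem_realizableSet] at hτ
    obtain ⟨⟨hreal, h0⟩, hcard⟩ := hτ
    have h6 : ((zeroSet τ) ×ˢ ({1, -1} : Finset SignType)).card = 6 := by
      rw [Finset.card_product, hcard]; rfl
    rw [← h6]
    symm
    have hback : ∀ (i : Fin n) (s : SignType), τ i = 0 →
        τ = Function.update (Function.update τ i s) i 0 := fun i s hi => by
      rw [Function.update_idem, ← hi, Function.update_eq_self]
    refine Finset.card_bij (fun p _ => Function.update τ p.1 p.2) ?_ ?_ ?_
    · rintro ⟨i, s⟩ hp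
      rw [Finset.mem_product, mem_zeroSet] at hp
      have hs : s ≠ 0 := mem_one_neg_one.1 hp.2
      obtain ⟨hc, hc'⟩ := conforms_and_card_iff.2
        ⟨i, by simpa using hs, hback i s hp.1⟩
      simp only [Finset.bipartiteBelow, Finset.mem_filter, mem_realizableSet]
      exact ⟨⟨⟨hreal.of_conforms hG hn h0 hc, hc.ne_zero h0⟩, by omega⟩, hc⟩
    · rintro ⟨i, s⟩ hp ⟨j, t⟩ hq hpq
      rw [Finset.mem_product, mem_zeroSet] at hp hq
      have hs : s ≠ 0 := mem_one_neg_one.1 hp.2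
      have h7 := congrFun hpq i
      simp only [Function.update_self] at h7
      by_cases hij : i = j
      · subst hij
        rw [Function.update_self] at h7
        rw [h7]
      · rw [Function.update_of_ne hij] at h7
        exact absurd (h7.trans hp.1) hs
    · intro σ hσ
      simp only [Finset.bipartiteBelow, Finset.mem_filter, mem_realizableSet] at hσ
      obtain ⟨i, hi, rfl⟩ := conforms_and_card_iff.1 ⟨hσ.2, by omega⟩
      refine ⟨(i, σ i), ?_, ?_⟩
      · rw [Finset.mem_product, mem_zeroSet]
        exact ⟨by simp, mem_one_neg_one.2 hi⟩
      · simp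
  rw [Finset.sum_congr rfl h1, Finset.sum_congr rfl h2] at hdc
  simp only [Finset.sum_const, smul_eq_mul] at hdc
  unfold realizableCount
  omega

/-- Neighborliness gives the first two counts. The incidence count `f_2 = 3 f_3` turns Euler's
relation into `2 f_3 = f_1 - f_0`. -/
theorem realizableCount_eq (hε : ε ≠ 0) (hn : 4 ≤ n) (hG : GeneralPosition ε n)
    (hN : ∀ σ : Fin n → SignType, (zeroSet σ).card ≤ 1 → Realizable ε n σ) :
    realizableCount ε n 0 = 4 * 2 ^ (n - 2) ∧ realizableCount ε n 1 = 2 * n * 2 ^ (n - 2) ∧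
      realizableCount ε n 2 = 3 * (n - 2) * 2 ^ (n - 2) ∧
      realizableCount ε n 3 = (n - 2) * 2 ^ (n - 2) := by
  classical
  have hne : ∀ σ : Fin n → SignType, (zeroSet σ).card ≤ 1 → σ ≠ 0 := by
    rintro σ h rfl
    simp [zeroSet] at h
    omega
  have h0 : realizableCount ε n 0 = 2 ^ n := by
    have h := card_full_conforms (0 : Fin n → SignType)
    rw [show (zeroSet (0 : Fin n → SignType)).card = n by simp [zeroSet]] at h
    rw [← h, realizableCount]
    congr 1
    ext σ
    simp only [Finset.mem_filter, mem_realizableSet, Finset.mem_univ, true_and,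
      Finset.card_eq_zero, Finset.eq_empty_iff_forall_notMem, mem_zeroSet]
    constructor
    · exact fun h => ⟨fun i hi => absurd rfl hi, h.2⟩
    · rintro ⟨_, h⟩
      have hz : (zeroSet σ).card = 0 := by
        rw [Finset.card_eq_zero, Finset.eq_empty_iff_forall_notMem]
        exact fun i hi => h i (mem_zeroSet.1 hi)
      exact ⟨⟨hN σ (by omega), hne σ (by omega)⟩, h⟩
  have h1 : realizableCount ε n 1 = n * 2 ^ (n - 1) := by
    rw [← card_one_zero, realizableCount]
    congr 1
    ext σ
    simp only [Finset.mem_filter, mem_realizableSet, Finset.mem_univ, true_and,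
      and_iff_right_iff_imp]
    exact fun h => ⟨hN σ h.le, hne σ h.le⟩
  have h2 := two_mul_realizableCount_two hG hn
  have h3 := euler_relation hε hn hG
  obtain ⟨m, rfl⟩ : ∃ m, n = m + 2 := ⟨n - 2, by omega⟩
  simp only [Nat.add_sub_cancel, show m + 2 - 1 = m + 1 from rfl] at *
  rw [pow_succ] at h1
  rw [pow_add] at h0
  refine ⟨by rw [h0]; ring, by rw [h1]; ring, ?_, ?_⟩ <;>
  · rw [h0, h1] at h3
    push_cast at h3
    zify at h2 ⊢
    linarith

end Realizable

/-- A system of equations `x i = Φ i x`, where the right hand side depends only on the `x j` with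
`j` below `i` in a well-founded order, is solvable. -/
theorem exists_triangular {ι : Type*} {r : ι → ι → Prop} (hr : WellFounded r)
    (Φ : ι → (ι → ℝ) → ℝ) (h : ∀ i x x', (∀ j, r j i → x j = x' j) → Φ i x = Φ i x') :
    ∃ x : ι → ℝ, ∀ i, x i = Φ i x := by
  classical
  refine ⟨hr.fix fun i rec => Φ i fun j => if hj : r j i then rec j hj else 0, fun i => ?_⟩
  rw [hr.fix_eq]
  refine h i _ _ fun j hj => ?_
  rw [dif_pos hj]

/-! ### Face lattices of cube type -/

section CubeParam

/-- A parametrization of the nonempty faces of `P` by sign vectors, as for a cube. -/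
structure IsCubeParam {d : ℕ} {ι : Type*} (P : Set (EuclideanSpace ℝ (Fin d)))
    (F : (ι → SignType) → Set (EuclideanSpace ℝ (Fin d))) : Prop where
  exposed : ∀ σ, IsExposed ℝ P (F σ)
  nonempty : ∀ σ, (F σ).Nonempty
  exists_eq : ∀ G, IsExposed ℝ P G → G.Nonempty → ∃ σ, G = F σ
  subset_iff : ∀ σ τ, F σ ⊆ F τ ↔ Conforms τ σ

variable {d e : ℕ} {ι κ : Type*} {P : Set (EuclideanSpace ℝ (Fin d))}
  {Q : Set (EuclideanSpace ℝ (Fin e))}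

/-- The empty face together with the parametrized faces. -/
def IsCubeParam.toFace {F : (ι → SignType) → Set (EuclideanSpace ℝ (Fin d))}
    (h : IsCubeParam P F) : Option (ι → SignType) → Face P
  | none => ⟨∅, isExposed_empty⟩
  | some σ => ⟨F σ, h.exposed σ⟩

theorem IsCubeParam.toFace_bijective {F : (ι → SignType) → Set (EuclideanSpace ℝ (Fin d))}
    (h : IsCubeParam P F) : Function.Bijective h.toFace := by
  constructor
  · rintro (_ | σ) (_ | τ) hστ
    · rfl
    · exact absurd (congrArg Subtype.val hστ).symm (h.nonempty τ).ne_empty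
    · exact absurd (congrArg Subtype.val hστ) (h.nonempty σ).ne_empty
    · have h' : F σ = F τ := congrArg Subtype.val hστ
      rw [((h.subset_iff σ τ).1 h'.subset).antisymm ((h.subset_iff τ σ).1 h'.symm.subset)]
  · rintro ⟨G, hG⟩
    rcases G.eq_empty_or_nonempty with rfl | hne
    · exact ⟨none, rfl⟩
    · obtain ⟨σ, rfl⟩ := h.exists_eq G hG hne
      exact ⟨some σ, rfl⟩

theorem IsCubeParam.toFace_le_iff {F : (ι → SignType) → Set (EuclideanSpace ℝ (Fin d))}
    {F' : (ι → SignType) → Set (EuclideanSpace ℝ (Fin e))}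
    (h : IsCubeParam P F) (h' : IsCubeParam Q F') (a b : Option (ι → SignType)) :
    h.toFace a ≤ h.toFace b ↔ h'.toFace a ≤ h'.toFace b := by
  rcases a with _ | σ <;> rcases b with _ | τ
  · exact iff_of_true le_rfl le_rfl
  · exact iff_of_true (Set.empty_subset _) (Set.empty_subset _)
  · exact iff_of_false (fun hs => (h.nonempty σ).ne_empty (Set.subset_empty_iff.1 hs))
      (fun hs => (h'.nonempty σ).ne_empty (Set.subset_empty_iff.1 hs))
  · exact (h.subset_iff σ τ).trans (h'.subset_iff σ τ).symm

theorem IsCubeParam.combEquiv {F : (ι → SignType) → Set (EuclideanSpace ℝ (Fin d))}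
    {F' : (ι → SignType) → Set (EuclideanSpace ℝ (Fin e))}
    (h : IsCubeParam P F) (h' : IsCubeParam Q F') : CombEquiv P Q := by
  refine ⟨⟨(Equiv.ofBijective _ h.toFace_bijective).symm.trans
    (Equiv.ofBijective _ h'.toFace_bijective), ?_⟩⟩
  intro a b
  obtain ⟨a, rfl⟩ := h.toFace_bijective.2 a
  obtain ⟨b, rfl⟩ := h.toFace_bijective.2 b
  simp only [Equiv.trans_apply, Equiv.ofBijective_symm_apply_apply, Equiv.ofBijective_apply]
  exact (h.toFace_le_iff h' a b).symm

theorem IsCubeParam.reindex {F : (ι → SignType) → Set (EuclideanSpace ℝ (Fin d))}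
    (h : IsCubeParam P F) (f : ι ≃ κ) : IsCubeParam P fun σ : κ → SignType => F (σ ∘ f) where
  exposed σ := h.exposed _
  nonempty σ := h.nonempty _
  exists_eq G hG hne := by
    obtain ⟨σ, rfl⟩ := h.exists_eq G hG hne
    exact ⟨σ ∘ f.symm, by simp [Function.comp_assoc]⟩
  subset_iff σ τ := by
    rw [h.subset_iff]
    exact ⟨fun hc i hi => by simpa using hc (f.symm i) (by simpa using hi),
      fun hc i hi => hc (f i) hi⟩

end CubeParam

section Functional

variable {d : ℕ}

/-- The linear functional with given coefficients. -/
noncomputable def coordFunctional (c : Fin d → ℝ) : EuclideanSpace ℝ (Fin d) →L[ℝ] ℝ :=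
  ∑ j, c j • EuclideanSpace.proj j

theorem coordFunctional_apply (c : Fin d → ℝ) (x : EuclideanSpace ℝ (Fin d)) :
    coordFunctional c x = ∑ j, c j * x j := by
  simp [coordFunctional]

theorem exists_coordFunctional_eq (l : EuclideanSpace ℝ (Fin d) →L[ℝ] ℝ) :
    ∃ c, l = coordFunctional c := by
  refine ⟨fun j => l (EuclideanSpace.single j 1), ?_⟩
  ext x
  rw [coordFunctional_apply]
  conv_lhs => rw [← (EuclideanSpace.basisFun (Fin d) ℝ).sum_repr x]
  simp [mul_comm]

end Functional

/-! ### Faces of the standard cube -/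

/-- The nonempty faces of the standard cube. -/
def stdCubeFace (k : ℕ) (σ : Fin k → SignType) : Set (EuclideanSpace ℝ (Fin k)) :=
  {x ∈ stdCube k | ∀ i, (σ i = 1 → x i = 1) ∧ (σ i = -1 → x i = 0)}

/-- The centre of the face: the free coordinates `1 / 2` keep it off every smaller face. -/
theorem exists_mem_stdCubeFace {k : ℕ} (σ : Fin k → SignType) :
    ∃ x ∈ stdCubeFace k σ, ∀ i, σ i = 0 → x i = 1 / 2 := by
  refine ⟨WithLp.toLp 2 fun i => (1 + (σ i : ℝ)) / 2, ⟨fun i => ?_, fun i => ?_⟩, fun i hi => ?_⟩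
  · cases h : σ i <;> norm_num [h]
  · cases h : σ i <;> norm_num [h] <;> decide
  · norm_num [hi]

theorem stdCube_argmax {k : ℕ} (c : Fin k → ℝ) :
    stdCubeFace k (fun i => SignType.sign (c i))
      = {x ∈ stdCube k | ∀ z ∈ stdCube k, coordFunctional c z ≤ coordFunctional c x} := by
  have hterm : ∀ x ∈ stdCube k, ∀ i, c i * x i ≤ max (c i) 0 ∧ (c i * x i = max (c i) 0 ↔
      (SignType.sign (c i) = 1 → x i = 1) ∧ (SignType.sign (c i) = -1 → x i = 0)) := by
    intro x hx i
    obtain ⟨h0, h1⟩ := hx i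
    rcases lt_trichotomy (c i) 0 with h | h | h
    · rw [max_eq_right h.le, sign_neg h]
      refine ⟨mul_nonpos_of_nonpos_of_nonneg h.le h0, ?_⟩
      simp [h.ne]
    · simp [h]
    · rw [max_eq_left h.le, sign_pos h]
      refine ⟨mul_le_of_le_one_right h.le h1, ?_⟩
      simp [h.ne']
  have hle : ∀ x ∈ stdCube k, coordFunctional c x ≤ ∑ i, max (c i) 0 := fun x hx => by
    rw [coordFunctional_apply]
    exact Finset.sum_le_sum fun i _ => (hterm x hx i).1
  have heq : ∀ x ∈ stdCube k, (coordFunctional c x = ∑ i, max (c i) 0 ↔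
      x ∈ stdCubeFace k (fun i => SignType.sign (c i))) := fun x hx => by
    rw [coordFunctional_apply, Finset.sum_eq_sum_iff_of_le fun i _ => (hterm x hx i).1]
    simp only [Finset.mem_univ, true_imp_iff, fun i => (hterm x hx i).2]
    exact ⟨fun h => ⟨hx, h⟩, fun h => h.2⟩
  obtain ⟨p, hp, _⟩ := exists_mem_stdCubeFace (fun i => SignType.sign (c i))
  ext x
  constructor
  · intro hx
    exact ⟨hx.1, fun z hz => ((heq x hx.1).2 hx).symm ▸ hle z hz⟩
  · rintro ⟨hx, hmax⟩
    refine (heq x hx).1 (le_antisymm (hle x hx) ?_)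
    rw [← (heq p hp.1).2 hp]
    exact hmax p hp.1

theorem isCubeParam_stdCube (k : ℕ) : IsCubeParam (stdCube k) (stdCubeFace k) where
  exposed σ _ := by
    refine ⟨coordFunctional fun i => (σ i : ℝ), ?_⟩
    rw [← stdCube_argmax]
    congr 1
    funext i
    cases σ i <;> simp
  nonempty σ := by
    obtain ⟨x, hx, _⟩ := exists_mem_stdCubeFace σ
    exact ⟨x, hx⟩
  exists_eq G hG hne := by
    obtain ⟨l, rfl⟩ := hG hne
    obtain ⟨c, rfl⟩ := exists_coordFunctional_eq l
    exact ⟨_, (stdCube_argmax c).symm⟩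
  subset_iff σ τ := by
    constructor
    · intro h i hi
      obtain ⟨x, hx, hx0⟩ := exists_mem_stdCubeFace σ
      have h1 := (h hx).2 i
      have h2 := hx.2 i
      have h3 := hx0 i
      cases hτ : τ i <;> cases hσ : σ i <;> simp_all
    · rintro h x ⟨hx, hx'⟩
      refine ⟨hx, fun i => ⟨fun hi => (hx' i).1 ?_, fun hi => (hx' i).2 ?_⟩⟩ <;>
      · rw [h i (by rw [hi]; decide), hi]

/-! ### The deformed cube: faces, vertices, directions -/

section DeformedCube

variable {n : ℕ} {ε : ℝ}

/-- The `i`-th row of the strictly lower triangular part, applied to `x`. -/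
def galeRow (i : Fin n) (x : EuclideanSpace ℝ (Fin n)) : ℝ := ∑ j, galeEntry n i j * x j

theorem galeRow_add (i : Fin n) (x y : EuclideanSpace ℝ (Fin n)) :
    galeRow i (x + y) = galeRow i x + galeRow i y := by
  simp [galeRow, mul_add, Finset.sum_add_distrib]

theorem galeRow_smul (i : Fin n) (c : ℝ) (x : EuclideanSpace ℝ (Fin n)) :
    galeRow i (c • x) = c * galeRow i x := by
  simp [galeRow, Finset.mul_sum, mul_left_comm]

theorem galeRow_sub (i : Fin n) (x y : EuclideanSpace ℝ (Fin n)) :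
    galeRow i (x - y) = galeRow i x - galeRow i y := by
  simp [galeRow, mul_sub, Finset.sum_sub_distrib]

theorem galeEntry_of_not_lt {i j : Fin n} (h : ¬ j < i) : galeEntry n i j = 0 := by
  simp [galeEntry, h]

theorem abs_galeEntry_le (i j : Fin n) : |galeEntry n i j| ≤ 3 := by
  unfold galeEntry
  split_ifs
  · rw [abs_mul, abs_pow, abs_neg, abs_one, one_pow, one_mul, Nat.abs_cast]
    have : Nat.choose 3 ((i : ℕ) - j - 1) ≤ 3 := by
      rcases le_or_gt ((i : ℕ) - j - 1) 3 with h | h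
      · interval_cases ((i : ℕ) - j - 1) <;> decide
      · rw [Nat.choose_eq_zero_of_lt h]; norm_num
    exact_mod_cast this
  · simp

theorem galeRow_congr {i : Fin n} {x y : EuclideanSpace ℝ (Fin n)} (h : ∀ j < i, x j = y j) :
    galeRow i x = galeRow i y := by
  refine Finset.sum_congr rfl fun j _ => ?_
  by_cases hj : j < i
  · rw [h j hj]
  · rw [galeEntry_of_not_lt hj]; simp

theorem continuous_galeRow (i : Fin n) :
    Continuous (galeRow i : EuclideanSpace ℝ (Fin n) → ℝ) := by
  unfold galeRow
  fun_prop

/-- The parameter is so small that the deformed cube is a cube combinatorially. -/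
structure SmallParam (n : ℕ) (ε : ℝ) : Prop where
  pos : 0 < ε
  le_one : ε ≤ 1
  -- A row has at most `n` entries of size at most `3`, applied to coordinates of size at most `2 ε
  -- · ε^(-2i)`. The resulting `6 n ε` has to be at most `1 / 2`.
  mul_le : 12 * n * ε ≤ 1

theorem SmallParam.bound_pos (hε : SmallParam n ε) (i : ℕ) : 0 < (ε⁻¹) ^ (2 * i) :=
  pow_pos (inv_pos.2 hε.pos) _

/-- The lower triangular part uses at most half of the bound in its row. Inductively `ε |x j| ≤ 2
ε^(-2j)`, and passing to row `i > j` gains a factor `ε^2`. -/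
theorem SmallParam.abs_galeRow_le (hε : SmallParam n ε) {x : EuclideanSpace ℝ (Fin n)}
    {i : Fin n} (h : ∀ j < i, ε * |x j| + galeRow j x ≤ (ε⁻¹) ^ (2 * (j : ℕ))) :
    |galeRow i x| ≤ (ε⁻¹) ^ (2 * (i : ℕ)) / 2 := by
  induction i using WellFoundedLT.induction with
  | ind i ih =>
    have hpos := hε.pos
    have hbi := hε.bound_pos i
    have hx : ∀ j < i, |x j| ≤ 2 * ε * (ε⁻¹) ^ (2 * (i : ℕ)) := by
      intro j hj
      have h1 := ih j hj fun k hk => h k (hk.trans hj)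
      have h2 := h j hj
      have h3 := abs_le.1 h1
      have h4 : ε * |x j| ≤ 2 * (ε⁻¹) ^ (2 * (j : ℕ)) := by
        have := hε.bound_pos j
        linarith [h3.1]
      have h5 : (ε⁻¹) ^ (2 * (j : ℕ) + 2) ≤ (ε⁻¹) ^ (2 * (i : ℕ)) :=
        pow_le_pow_right₀ ((one_le_inv₀ hpos).2 hε.le_one) (by
          have : (j : ℕ) < i := hj
          omega)
      rw [pow_add] at h5
      have h6 : (ε⁻¹) ^ (2 * (j : ℕ)) ≤ ε ^ 2 * (ε⁻¹) ^ (2 * (i : ℕ)) := by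
        calc (ε⁻¹) ^ (2 * (j : ℕ)) = ε ^ 2 * ((ε⁻¹) ^ (2 * (j : ℕ)) * ε⁻¹ ^ 2) := by
              field_simp
          _ ≤ _ := by gcongr
      have h7 : ε * |x j| ≤ ε * (2 * ε * (ε⁻¹) ^ (2 * (i : ℕ))) := by
        calc ε * |x j| ≤ 2 * (ε ^ 2 * (ε⁻¹) ^ (2 * (i : ℕ))) := by linarith
          _ = _ := by ring
      exact le_of_mul_le_mul_left h7 hpos
    have hsum : |galeRow i x| ≤ ∑ _j : Fin n, 3 * (2 * ε * (ε⁻¹) ^ (2 * (i : ℕ))) := by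
      refine (Finset.abs_sum_le_sum_abs _ _).trans (Finset.sum_le_sum fun j _ => ?_)
      by_cases hj : j < i
      · rw [abs_mul]
        exact mul_le_mul (abs_galeEntry_le i j) (hx j hj) (abs_nonneg _) (by norm_num)
      · rw [galeEntry_of_not_lt hj]
        simp only [zero_mul, abs_zero]
        positivity
    refine hsum.trans ?_
    rw [Finset.sum_const, Finset.card_univ, Fintype.card_fin, nsmul_eq_mul]
    have := mul_le_mul_of_nonneg_right hε.mul_le hbi.le
    linarith

theorem mem_deformedCube {x : EuclideanSpace ℝ (Fin n)} :
    x ∈ deformedCube n ε ↔ ∀ i, ε * |x i| + galeRow i x ≤ (ε⁻¹) ^ (2 * (i : ℕ)) := Iff.rfl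

theorem SmallParam.galeRow_lt (hε : SmallParam n ε) {x : EuclideanSpace ℝ (Fin n)}
    (hx : x ∈ deformedCube n ε) (i : Fin n) : galeRow i x < (ε⁻¹) ^ (2 * (i : ℕ)) := by
  have h1 := hε.abs_galeRow_le (i := i) fun j _ => mem_deformedCube.1 hx j
  have h2 := hε.bound_pos i
  linarith [(abs_le.1 h1).2]

/-- The face of the deformed cube given by a sign vector. -/
def cubeFace (n : ℕ) (ε : ℝ) (σ : Fin n → SignType) : Set (EuclideanSpace ℝ (Fin n)) :=
  {x ∈ deformedCube n ε |
    ∀ i, σ i ≠ 0 → ε * ((σ i : ℝ) * x i) + galeRow i x = (ε⁻¹) ^ (2 * (i : ℕ))}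

theorem sign_cast_mul_self {s : SignType} (h : s ≠ 0) : (s : ℝ) * s = 1 := by
  cases s <;> simp_all

theorem abs_sign_cast {s : SignType} (h : s ≠ 0) : |(s : ℝ)| = 1 := by
  cases s <;> simp_all

/-- Rows are checked in increasing order, so the bound on `galeRow i x` may be assumed at free rows.
At a signed row it forces `σ i * x i > 0`, and the equation then covers both inequalities. -/
theorem SmallParam.mem_cubeFace (hε : SmallParam n ε) {σ : Fin n → SignType}
    {x : EuclideanSpace ℝ (Fin n)}
    (h0 : ∀ i, σ i = 0 → |galeRow i x| ≤ (ε⁻¹) ^ (2 * (i : ℕ)) / 2 →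
      ε * |x i| + galeRow i x ≤ (ε⁻¹) ^ (2 * (i : ℕ)))
    (h1 : ∀ i, σ i ≠ 0 → ε * ((σ i : ℝ) * x i) + galeRow i x = (ε⁻¹) ^ (2 * (i : ℕ))) :
    x ∈ cubeFace n ε σ := by
  refine ⟨mem_deformedCube.2 fun i => ?_, h1⟩
  induction i using WellFoundedLT.induction with
  | ind i ih =>
    by_cases hi : σ i = 0
    · exact h0 i hi (hε.abs_galeRow_le ih)
    · have h2 := (abs_le.1 (hε.abs_galeRow_le ih)).2
      have h3 := hε.bound_pos i
      have h4 := h1 i hi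
      have h5 : 0 < (σ i : ℝ) * x i := by
        have : 0 < ε * ((σ i : ℝ) * x i) := by linarith
        exact pos_of_mul_pos_right this hε.pos.le
      rw [← h4, ← one_mul |x i|, ← abs_sign_cast hi, ← abs_mul, abs_of_pos h5]

theorem SmallParam.exists_mem_cubeFace (hε : SmallParam n ε) (σ : Fin n → SignType) :
    ∃ x ∈ cubeFace n ε σ, ∀ i, σ i = 0 → x i = 0 := by
  obtain ⟨x, hx⟩ := exists_triangular (ι := Fin n) wellFounded_lt
    (fun i x => (σ i : ℝ) * ((ε⁻¹) ^ (2 * (i : ℕ)) - galeRow i (WithLp.toLp 2 x)) / ε) (by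
      intro i x x' h
      rw [galeRow_congr (i := i) (y := WithLp.toLp 2 x') (by simpa using h)])
  have h0 : ∀ i, σ i = 0 → x i = 0 := fun i hi => by rw [hx i, hi]; simp
  refine ⟨WithLp.toLp 2 x, ?_, h0⟩
  have h1 : ∀ i, σ i ≠ 0 → ε * ((σ i : ℝ) * x i) + galeRow i (WithLp.toLp 2 x)
      = (ε⁻¹) ^ (2 * (i : ℕ)) := by
    intro i hi
    rw [hx i, mul_div_assoc', ← mul_assoc, sign_cast_mul_self hi, mul_div_cancel₀ _ hε.pos.ne']
    ring
  refine hε.mem_cubeFace (fun i hi hb => ?_) h1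
  have h2 := hε.bound_pos i
  change ε * |x i| + _ ≤ _
  rw [h0 i hi, abs_zero, mul_zero]
  linarith [(abs_le.1 hb).2]

theorem cubeFace_zero : cubeFace n ε 0 = deformedCube n ε := by
  ext x; simp [cubeFace]

theorem cubeFace_subset_of_conforms {σ τ : Fin n → SignType} (h : Conforms τ σ) :
    cubeFace n ε σ ⊆ cubeFace n ε τ := fun x hx =>
  ⟨hx.1, fun i hi => by
    have := h i hi
    rw [← this]
    exact hx.2 i (by rwa [this])⟩

/-- The central point has slack at its free rows, and at no row can both signs be tight, since that
would leave `galeRow` equal to the bound. It therefore detects exactly which faces contain its face.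
-/
theorem SmallParam.conforms_of_mem (hε : SmallParam n ε) {σ τ : Fin n → SignType}
    {x : EuclideanSpace ℝ (Fin n)} (hx : x ∈ cubeFace n ε σ) (h0 : ∀ i, σ i = 0 → x i = 0)
    (hτ : x ∈ cubeFace n ε τ) : Conforms τ σ := by
  intro i hi
  have h1 := hτ.2 i hi
  have h2 := hε.galeRow_lt hx.1 i
  by_cases hσ : σ i = 0
  · rw [h0 i hσ] at h1
    linarith
  · have h3 := hx.2 i hσ
    revert hi hσ
    cases hs : σ i <;> cases ht : τ i <;> simp_all <;> linarith

theorem SmallParam.cubeFace_subset_iff (hε : SmallParam n ε) (σ τ : Fin n → SignType) :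
    cubeFace n ε σ ⊆ cubeFace n ε τ ↔ Conforms τ σ := by
  refine ⟨fun h => ?_, cubeFace_subset_of_conforms⟩
  obtain ⟨x, hx, h0⟩ := hε.exists_mem_cubeFace σ
  exact hε.conforms_of_mem hx h0 (h hx)

/-- The coefficient of a row in a functional: fixed signs are used linearly, free signs through
the absolute value. -/
noncomputable def mixAbs (s : SignType) (r : ℝ) : ℝ := if s = 0 then |r| else s * r

/-- The functional that is the combination of the facet normals with the coefficients `y`. -/
noncomputable def coneVec (ε : ℝ) (σ : Fin n → SignType) (y : Fin n → ℝ) (j : Fin n) : ℝ :=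
  ε * y j + ∑ i, mixAbs (σ i) (y i) * galeEntry n i j

/-- The free signs of `σ` are replaced by those of `y`. -/
noncomputable def joinSign (σ : Fin n → SignType) (y : Fin n → ℝ) (i : Fin n) : SignType :=
  if σ i = 0 then SignType.sign (y i) else σ i

theorem conforms_joinSign (σ : Fin n → SignType) (y : Fin n → ℝ) :
    Conforms σ (joinSign σ y) := fun _ hi => if_neg hi

/-- Back substitution from the last coordinate: the entry `y j` enters with coefficient `ε`, and
otherwise only `y i` with `i > j` occur. -/
theorem exists_coneVec_eq (hε : ε ≠ 0) (σ : Fin n → SignType) (c : Fin n → ℝ) :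
    ∃ y, coneVec ε σ y = c := by
  obtain ⟨y, hy⟩ := exists_triangular (ι := Fin n) (r := (· > ·)) wellFounded_gt
    (fun j y => (c j - ∑ i, mixAbs (σ i) (y i) * galeEntry n i j) / ε) (by
      intro j y y' h
      congr 2
      refine Finset.sum_congr rfl fun i _ => ?_
      by_cases hij : j < i
      · rw [h i hij]
      · rw [galeEntry_of_not_lt hij]; simp)
  refine ⟨y, funext fun j => ?_⟩
  have := hy j
  rw [eq_div_iff hε] at this
  simp only [coneVec]
  linarith

theorem coordFunctional_coneVec (ε : ℝ) (σ : Fin n → SignType) (y : Fin n → ℝ)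
    (x : EuclideanSpace ℝ (Fin n)) : coordFunctional (coneVec ε σ y) x
      = ∑ i, (ε * y i * x i + mixAbs (σ i) (y i) * galeRow i x) := by
  rw [coordFunctional_apply, Finset.sum_add_distrib]
  simp only [coneVec, add_mul, Finset.sum_add_distrib, galeRow, Finset.sum_mul, Finset.mul_sum]
  congr 1
  rw [Finset.sum_comm]
  exact Finset.sum_congr rfl fun i _ => Finset.sum_congr rfl fun j _ => by ring

/-- Linear programming duality with an explicit certificate: on the face `σ` each summand is bounded
by its multiple of the right-hand side, with equality exactly when the row prescribed by `joinSign`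
is tight. All bounds are attained together because that face is nonempty. -/
theorem SmallParam.cubeFace_argmax (hε : SmallParam n ε) (σ : Fin n → SignType)
    (y : Fin n → ℝ) : cubeFace n ε (joinSign σ y) = {x ∈ cubeFace n ε σ | ∀ z ∈ cubeFace n ε σ,
      coordFunctional (coneVec ε σ y) z ≤ coordFunctional (coneVec ε σ y) x} := by
  have hpos := hε.pos
  have hterm : ∀ x ∈ cubeFace n ε σ, ∀ i,
      ε * y i * x i + mixAbs (σ i) (y i) * galeRow i x
        ≤ mixAbs (σ i) (y i) * (ε⁻¹) ^ (2 * (i : ℕ)) ∧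
      (ε * y i * x i + mixAbs (σ i) (y i) * galeRow i x
        = mixAbs (σ i) (y i) * (ε⁻¹) ^ (2 * (i : ℕ)) ↔
      (joinSign σ y i ≠ 0 →
        ε * ((joinSign σ y i : ℝ) * x i) + galeRow i x = (ε⁻¹) ^ (2 * (i : ℕ)))) := by
    intro x hx i
    have hxi := mem_deformedCube.1 hx.1 i
    by_cases hi : σ i = 0
    · have h1 := mul_le_mul_of_nonneg_left (le_abs_self (x i)) hpos.le
      have h2 := mul_le_mul_of_nonneg_left (neg_abs_le (x i)) hpos.le
      rw [joinSign, if_pos hi, mixAbs, if_pos hi]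
      rcases lt_trichotomy (y i) 0 with h | h | h
      · rw [abs_of_neg h, sign_neg h]
        have h3 : ε * y i * x i + -y i * galeRow i x = -y i * (ε * (-1 * x i) + galeRow i x) := by
          ring
        have h4 : 0 < -y i := by linarith
        rw [h3]
        refine ⟨mul_le_mul_of_nonneg_left (by linarith) h4.le, ?_⟩
        rw [mul_right_inj' h4.ne']
        simp
      · simp [h]
      · rw [abs_of_pos h, sign_pos h]
        have h3 : ε * y i * x i + y i * galeRow i x = y i * (ε * (1 * x i) + galeRow i x) := by
          ring
        rw [h3]
        refine ⟨mul_le_mul_of_nonneg_left (by linarith) h.le, ?_⟩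
        rw [mul_right_inj' h.ne']
        simp
    · have h1 := hx.2 i hi
      rw [joinSign, if_neg hi, mixAbs, if_neg hi]
      have h2 : ε * y i * x i + σ i * y i * galeRow i x
          = σ i * y i * (ε⁻¹) ^ (2 * (i : ℕ)) := by
        rw [← h1]
        linear_combination (-(ε * y i * x i)) * sign_cast_mul_self hi
      exact ⟨h2.le, iff_of_true h2 fun _ => h1⟩
  have hle : ∀ x ∈ cubeFace n ε σ, coordFunctional (coneVec ε σ y) x
      ≤ ∑ i, mixAbs (σ i) (y i) * (ε⁻¹) ^ (2 * (i : ℕ)) := fun x hx => by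
    rw [coordFunctional_coneVec]
    exact Finset.sum_le_sum fun i _ => (hterm x hx i).1
  have heq : ∀ x ∈ cubeFace n ε σ, (coordFunctional (coneVec ε σ y) x
      = ∑ i, mixAbs (σ i) (y i) * (ε⁻¹) ^ (2 * (i : ℕ)) ↔
        x ∈ cubeFace n ε (joinSign σ y)) := fun x hx => by
    rw [coordFunctional_coneVec, Finset.sum_eq_sum_iff_of_le fun i _ => (hterm x hx i).1]
    simp only [Finset.mem_univ, true_imp_iff, fun i => (hterm x hx i).2]
    exact ⟨fun h => ⟨hx.1, h⟩, fun h => h.2⟩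
  have hsub := cubeFace_subset_of_conforms (ε := ε) (conforms_joinSign σ y)
  obtain ⟨p, hp, _⟩ := hε.exists_mem_cubeFace (joinSign σ y)
  ext x
  constructor
  · intro hx
    exact ⟨hsub hx, fun z hz => ((heq x (hsub hx)).2 hx).symm ▸ hle z hz⟩
  · rintro ⟨hx, hmax⟩
    refine (heq x hx).1 (le_antisymm (hle x hx) ?_)
    rw [← (heq p (hsub hp)).2 hp]
    exact hmax p (hsub hp)

theorem SmallParam.exists_argmax_eq (hε : SmallParam n ε) (σ : Fin n → SignType)
    (l : EuclideanSpace ℝ (Fin n) →L[ℝ] ℝ) : ∃ y, l = coordFunctional (coneVec ε σ y) ∧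
      {x ∈ cubeFace n ε σ | ∀ z ∈ cubeFace n ε σ, l z ≤ l x} = cubeFace n ε (joinSign σ y) := by
  obtain ⟨c, rfl⟩ := exists_coordFunctional_eq l
  obtain ⟨y, rfl⟩ := exists_coneVec_eq hε.pos.ne' σ c
  exact ⟨y, rfl, (hε.cubeFace_argmax σ y).symm⟩

theorem SmallParam.isCubeParam_deformedCube (hε : SmallParam n ε) :
    IsCubeParam (deformedCube n ε) (cubeFace n ε) where
  exposed σ _ := by
    refine ⟨coordFunctional (coneVec ε 0 fun i => (σ i : ℝ)), ?_⟩
    have h := hε.cubeFace_argmax 0 fun i => (σ i : ℝ)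
    rw [cubeFace_zero] at h
    rw [← h]
    congr 1
    funext i
    cases h : σ i <;> simp [joinSign, h]
  nonempty σ := by
    obtain ⟨x, hx, _⟩ := hε.exists_mem_cubeFace σ
    exact ⟨x, hx⟩
  exists_eq G hG hne := by
    obtain ⟨l, rfl⟩ := hG hne
    obtain ⟨y, _, hy⟩ := hε.exists_argmax_eq 0 l
    rw [cubeFace_zero] at hy
    exact ⟨_, hy⟩
  subset_iff := hε.cubeFace_subset_iff

theorem convex_cubeFace (hε : 0 ≤ ε) (σ : Fin n → SignType) : Convex ℝ (cubeFace n ε σ) := by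
  rintro x ⟨hx, hx'⟩ z ⟨hz, hz'⟩ a b ha hb hab
  refine ⟨mem_deformedCube.2 fun i => ?_, fun i hi => ?_⟩
  · rw [galeRow_add, galeRow_smul, galeRow_smul]
    have h1 := mul_le_mul_of_nonneg_left (mem_deformedCube.1 hx i) ha
    have h2 := mul_le_mul_of_nonneg_left (mem_deformedCube.1 hz i) hb
    have h3 : |(a • x + b • z) i| ≤ a * |x i| + b * |z i| := by
      have := abs_add_le (a * x i) (b * z i)
      rw [abs_mul, abs_mul, abs_of_nonneg ha, abs_of_nonneg hb] at this
      simpa using this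
    have h4 := mul_le_mul_of_nonneg_left h3 hε
    calc _ ≤ a * (ε⁻¹) ^ (2 * (i : ℕ)) + b * (ε⁻¹) ^ (2 * (i : ℕ)) := by linarith
      _ = _ := by rw [← add_mul, hab, one_mul]
  · rw [galeRow_add, galeRow_smul, galeRow_smul]
    simp only [PiLp.add_apply, PiLp.smul_apply, smul_eq_mul]
    linear_combination a * hx' i hi + b * hz' i hi + (ε⁻¹) ^ (2 * (i : ℕ)) * hab

open Classical in
/-- The vertex (or, if `σ` has zeros, the central point of the face) with the sign vector `σ`. -/
noncomputable def cubePoint (n : ℕ) (ε : ℝ) (σ : Fin n → SignType) : EuclideanSpace ℝ (Fin n) :=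
  if h : ∃ x ∈ cubeFace n ε σ, ∀ i, σ i = 0 → x i = 0 then h.choose else 0

theorem SmallParam.cubePoint_mem (hε : SmallParam n ε) (σ : Fin n → SignType) :
    cubePoint n ε σ ∈ cubeFace n ε σ := by
  rw [cubePoint, dif_pos (hε.exists_mem_cubeFace σ)]
  exact (hε.exists_mem_cubeFace σ).choose_spec.1

theorem SmallParam.cubePoint_apply (hε : SmallParam n ε) {σ : Fin n → SignType} {i : Fin n}
    (hi : σ i = 0) : cubePoint n ε σ i = 0 := by
  rw [cubePoint, dif_pos (hε.exists_mem_cubeFace σ)]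
  exact (hε.exists_mem_cubeFace σ).choose_spec.2 i hi

theorem SmallParam.cubePoint_mem_iff (hε : SmallParam n ε) (σ τ : Fin n → SignType) :
    cubePoint n ε σ ∈ cubeFace n ε τ ↔ Conforms τ σ :=
  ⟨hε.conforms_of_mem (hε.cubePoint_mem σ) fun _ => hε.cubePoint_apply,
    fun h => cubeFace_subset_of_conforms h (hε.cubePoint_mem σ)⟩

theorem SmallParam.eq_cubePoint (hε : SmallParam n ε) {σ : Fin n → SignType}
    (hσ : ∀ i, σ i ≠ 0) {x : EuclideanSpace ℝ (Fin n)} (hx : x ∈ cubeFace n ε σ) :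
    x = cubePoint n ε σ := by
  ext i
  induction i using WellFoundedLT.induction with
  | ind i ih =>
    have h1 := hx.2 i (hσ i)
    have h2 := (hε.cubePoint_mem σ).2 i (hσ i)
    rw [galeRow_congr ih] at h1
    have h3 : ε * ((σ i : ℝ) * x i) = ε * ((σ i : ℝ) * cubePoint n ε σ i) := by linarith
    have h4 := mul_left_cancel₀ hε.pos.ne' h3
    have h5 : (σ i : ℝ) ≠ 0 := by
      intro h
      have := sign_cast_mul_self (hσ i)
      simp [h] at this
    exact mul_left_cancel₀ h5 h4

theorem SmallParam.cubeFace_eq_singleton (hε : SmallParam n ε) {σ : Fin n → SignType}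
    (hσ : ∀ i, σ i ≠ 0) : cubeFace n ε σ = {cubePoint n ε σ} :=
  Set.eq_singleton_iff_unique_mem.2 ⟨hε.cubePoint_mem σ, fun _ hx => hε.eq_cubePoint hσ hx⟩

/-- A point outside the hull of the vertices could be strictly separated from it, but every
functional attains its maximum over the face on a subface, which contains a vertex. -/
theorem SmallParam.cubeFace_eq_convexHull (hε : SmallParam n ε) (σ : Fin n → SignType) :
    cubeFace n ε σ
      = convexHull ℝ (cubePoint n ε '' {ρ | Conforms σ ρ ∧ ∀ i, ρ i ≠ 0}) := by
  refine Set.Subset.antisymm (fun x hx => ?_) (convexHull_min ?_ (convex_cubeFace hε.pos.le σ))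
  · by_contra hcon
    have hfin : (cubePoint n ε '' {ρ | Conforms σ ρ ∧ ∀ i, ρ i ≠ 0}).Finite := Set.toFinite _
    obtain ⟨f, u, hf, hu⟩ := geometric_hahn_banach_closed_point (convex_convexHull ℝ _)
      (hfin.isClosed_convexHull ℝ) hcon
    obtain ⟨y, _, hy⟩ := hε.exists_argmax_eq σ f
    set ρ : Fin n → SignType := fun i => if joinSign σ y i = 0 then 1 else joinSign σ y i with hρ
    have hc : Conforms (joinSign σ y) ρ := fun _ hi => if_neg hi
    have hfull : ∀ i, ρ i ≠ 0 := fun i => by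
      simp only [hρ]
      split_ifs with h
      · decide
      · exact h
    have h1 : cubePoint n ε ρ ∈ cubeFace n ε (joinSign σ y) := (hε.cubePoint_mem_iff _ _).2 hc
    rw [← hy] at h1
    have h2 := h1.2 x hx
    have h3 := hf (cubePoint n ε ρ) (subset_convexHull ℝ _
      ⟨ρ, ⟨(conforms_joinSign σ y).trans hc, hfull⟩, rfl⟩)
    linarith
  · rintro _ ⟨ρ, hρ, rfl⟩
    exact (hε.cubePoint_mem_iff _ _).2 hρ.1

theorem SmallParam.isPolytope_deformedCube (hε : SmallParam n ε) :
    IsPolytope (deformedCube n ε) := by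
  have hfin : (cubePoint n ε '' {ρ | Conforms 0 ρ ∧ ∀ i, ρ i ≠ 0}).Finite := Set.toFinite _
  refine ⟨hfin.toFinset, ?_⟩
  rw [← cubeFace_zero, hfin.coe_toFinset, hε.cubeFace_eq_convexHull]

/-- Vertices of the deformed cube are rational if the parameter is. -/
theorem SmallParam.cubePoint_rational {q : ℚ} (hε : SmallParam n q) {σ : Fin n → SignType}
    (hσ : ∀ i, σ i ≠ 0) (i : Fin n) : ∃ r : ℚ, cubePoint n q σ i = r := by
  induction i using WellFoundedLT.induction with
  | ind i ih =>
    have hG : ∃ r : ℚ, galeRow i (cubePoint n q σ) = r := by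
      have h1 : ∀ j, ∃ r : ℚ, galeEntry n i j * cubePoint n q σ j = r := by
        intro j
        by_cases hj : j < i
        · obtain ⟨r, hr⟩ := ih j hj
          rw [hr, galeEntry]
          split_ifs
          · exact ⟨(-1) ^ ((i : ℕ) - j - 1) * (Nat.choose 3 ((i : ℕ) - j - 1) : ℚ) * r, by
              push_cast; rfl⟩
          · exact ⟨0, by simp⟩
        · exact ⟨0, by simp [galeEntry_of_not_lt hj]⟩
      choose f hf using h1
      exact ⟨∑ j, f j, by rw [galeRow, Rat.cast_sum]; exact Finset.sum_congr rfl fun j _ => hf j⟩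
    obtain ⟨g, hg⟩ := hG
    have h1 := (hε.cubePoint_mem σ).2 i (hσ i)
    rw [hg] at h1
    have hq : (q : ℝ) ≠ 0 := hε.pos.ne'
    refine ⟨(SignType.cast (σ i) : ℚ) * (((q⁻¹) ^ (2 * (i : ℕ)) - g) / q), ?_⟩
    have h2 : (σ i : ℝ) * cubePoint n q σ i = ((q : ℝ)⁻¹ ^ (2 * (i : ℕ)) - g) / q := by
      rw [eq_div_iff hq]; linarith
    have h3 : ((SignType.cast (σ i) : ℚ) : ℝ) = (σ i : ℝ) := by cases σ i <;> simp
    push_cast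
    rw [h3, ← h2, ← mul_assoc, sign_cast_mul_self (hσ i), one_mul]

/-- The direction space of a face. -/
def faceDir (ε : ℝ) (σ : Fin n → SignType) : Submodule ℝ (EuclideanSpace ℝ (Fin n)) where
  carrier := {d | ∀ i, σ i ≠ 0 → ε * ((σ i : ℝ) * d i) + galeRow i d = 0}
  add_mem' {a b} ha hb i hi := by
    rw [galeRow_add, PiLp.add_apply]
    linear_combination ha i hi + hb i hi
  zero_mem' i hi := by simp [galeRow]
  smul_mem' c a ha i hi := by
    rw [galeRow_smul, PiLp.smul_apply, smul_eq_mul]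
    linear_combination c * ha i hi

theorem mem_faceDir {σ : Fin n → SignType} {d : EuclideanSpace ℝ (Fin n)} :
    d ∈ faceDir ε σ ↔ ∀ i, σ i ≠ 0 → ε * ((σ i : ℝ) * d i) + galeRow i d = 0 := Iff.rfl

/-- The central point satisfies the free rows strictly, so it can be moved a little in any direction
that preserves the tight rows. -/
theorem SmallParam.vectorSpan_cubeFace (hε : SmallParam n ε) (σ : Fin n → SignType) :
    vectorSpan ℝ (cubeFace n ε σ) = faceDir ε σ := by
  apply le_antisymm
  · rw [vectorSpan_def, Submodule.span_le]
    rintro _ ⟨x, hx, z, hz, rfl⟩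
    intro i hi
    change ε * ((σ i : ℝ) * (x - z) i) + galeRow i (x - z) = 0
    rw [galeRow_sub, PiLp.sub_apply]
    linear_combination hx.2 i hi - hz.2 i hi
  · intro d hd
    set p := cubePoint n ε σ with hp
    have hpm : p ∈ cubeFace n ε σ := hε.cubePoint_mem σ
    have hev : ∀ᶠ δ in 𝓝 (0 : ℝ), ∀ i, σ i = 0 →
        ε * |(p + δ • d) i| + galeRow i (p + δ • d) < (ε⁻¹) ^ (2 * (i : ℕ)) := by
      simp only [eventually_all]
      intro i hi
      have hcont : ContinuousAt
          (fun δ : ℝ => ε * |(p + δ • d) i| + galeRow i (p + δ • d)) 0 := by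
        have := continuous_galeRow i
        fun_prop
      refine hcont.eventually_lt_const ?_
      simp only [zero_smul, add_zero]
      rw [hp, hε.cubePoint_apply hi, abs_zero, mul_zero, zero_add]
      exact hε.galeRow_lt hpm.1 i
    obtain ⟨δ, hδ, hδ0⟩ := ((hev.filter_mono nhdsWithin_le_nhds).and
      (self_mem_nhdsWithin (s := Set.Ioi (0 : ℝ)))).exists
    have hmem : p + δ • d ∈ cubeFace n ε σ := by
      refine hε.mem_cubeFace (fun i hi _ => (hδ i hi).le) fun i hi => ?_
      rw [galeRow_add, galeRow_smul, PiLp.add_apply, PiLp.smul_apply, smul_eq_mul]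
      linear_combination hpm.2 i hi + δ * hd i hi
    have h1 := vsub_mem_vectorSpan ℝ hmem hpm
    rw [vsub_eq_sub, add_sub_cancel_left] at h1
    have h2 := Submodule.smul_mem _ δ⁻¹ h1
    rwa [smul_smul, inv_mul_cancel₀ (ne_of_gt hδ0), one_smul] at h2

/-- Forward substitution: the free coordinates are arbitrary, and each signed row determines its own
coordinate from the earlier ones. -/
theorem finrank_faceDir (hε : ε ≠ 0) (σ : Fin n → SignType) :
    Module.finrank ℝ (faceDir ε σ) = (zeroSet σ).card := by
  let A : faceDir ε σ →ₗ[ℝ] ({i // σ i = 0} → ℝ) :=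
    { toFun := fun d i => (d : EuclideanSpace ℝ (Fin n)) i
      map_add' := fun _ _ => rfl
      map_smul' := fun _ _ => rfl }
  have hinj : Function.Injective A := by
    rw [← LinearMap.ker_eq_bot, LinearMap.ker_eq_bot']
    rintro ⟨d, hd⟩ h0
    rw [Submodule.mk_eq_zero]
    ext i
    induction i using WellFoundedLT.induction with
    | ind i ih =>
      by_cases hi : σ i = 0
      · exact congrFun h0 ⟨i, hi⟩
      · have h1 := mem_faceDir.1 hd i hi
        rw [galeRow_congr (y := 0) ih] at h1
        have h2 : galeRow i (0 : EuclideanSpace ℝ (Fin n)) = 0 := by simp [galeRow]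
        have h3 : (σ i : ℝ) ≠ 0 := by
          intro h
          have := sign_cast_mul_self hi
          simp [h] at this
        rw [h2, add_zero] at h1
        simpa [hε, h3] using h1
  have hsurj : Function.Surjective A := by
    intro f
    obtain ⟨x, hx⟩ := exists_triangular (ι := Fin n) wellFounded_lt
      (fun i x => if h : σ i = 0 then f ⟨i, h⟩ else
        -((σ i : ℝ) * galeRow i (WithLp.toLp 2 x)) / ε) (by
        intro i x x' h
        rw [galeRow_congr (i := i) (y := WithLp.toLp 2 x') (by simpa using h)])
    refine ⟨⟨WithLp.toLp 2 x, fun i hi => ?_⟩, funext fun i => ?_⟩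
    · change ε * ((σ i : ℝ) * x i) + _ = 0
      rw [hx i, dif_neg hi]
      field_simp
      linear_combination (-galeRow i (WithLp.toLp 2 x)) * sign_cast_mul_self hi
    · change x i = f i
      rw [hx i, dif_pos i.2]
  rw [(LinearEquiv.ofBijective A ⟨hinj, hsurj⟩).finrank_eq, Module.finrank_fintype_fun_eq_card,
    Fintype.card_subtype]
  rfl

end DeformedCube

/-! ### Projection to the last four coordinates -/

section Projection

variable {n : ℕ} {ε : ℝ}

theorem sum_mul_galeEntry (f : ℕ → ℝ) {j : Fin n} (hj : (j : ℕ) + 4 < n) :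
    ∑ i : Fin n, f i * galeEntry n i j = f (j + 1) - 3 * f (j + 2) + 3 * f (j + 3) - f (j + 4) := by
  obtain ⟨m, hm⟩ : ∃ m, n = (j + 1) + (4 + m) := ⟨n - (j + 5), by omega⟩
  let G : ℕ → ℝ := fun i => f i * (if (j : ℕ) < i then
    (-1) ^ (i - j - 1) * (Nat.choose 3 (i - j - 1) : ℝ) else 0)
  have h1 : ∑ i : Fin n, f i * galeEntry n i j = ∑ i ∈ Finset.range n, G i := by
    rw [← Fin.sum_univ_eq_sum_range]
    refine Finset.sum_congr rfl fun i _ => ?_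
    simp only [galeEntry, hj, true_and, G, Fin.lt_def]
  have h5 : ∑ i ∈ Finset.range n, G i = ∑ i ∈ Finset.range (j + 1 + (4 + m)), G i := by rw [← hm]
  rw [h1, h5, Finset.sum_range_add _ ((j : ℕ) + 1) (4 + m), Finset.sum_range_add _ 4 m]
  have h2 : ∑ x ∈ Finset.range (j + 1), G x = 0 := Finset.sum_eq_zero fun x hx => by
    have : ¬ (j : ℕ) < x := by rw [Finset.mem_range] at hx; omega
    simp [G, this]
  have h3 : ∀ k, G (j + 1 + k) = f (j + 1 + k) * ((-1) ^ k * (Nat.choose 3 k : ℝ)) := fun k => by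
    have e1 : (j : ℕ) < j + 1 + k := by omega
    have e2 : (j : ℕ) + 1 + k - j - 1 = k := by omega
    simp only [G, e1, if_true, e2]
  have h4 : ∑ x ∈ Finset.range m, G (j + 1 + (4 + x)) = 0 := Finset.sum_eq_zero fun x _ => by
    rw [h3, Nat.choose_eq_zero_of_lt (by omega)]; simp
  have c1 : Nat.choose 3 1 = 3 := rfl
  have c2 : Nat.choose 3 2 = 3 := rfl
  have c3 : Nat.choose 3 3 = 1 := rfl
  rw [h2, h4, Finset.sum_range_succ, Finset.sum_range_succ, Finset.sum_range_succ,
    Finset.sum_range_one, h3, h3, h3, h3, c1, c2, c3]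
  simp only [add_assoc, Nat.reduceAdd, add_zero]
  norm_num
  ring

theorem coneVec_zero_eq (ε : ℝ) (y : ℕ → ℝ) {j : Fin n} (hj : (j : ℕ) + 4 < n) :
    coneVec ε (0 : Fin n → SignType) (fun i => y i) j = ε * y j +
      (|y (j + 1)| - 3 * |y (j + 2)| + 3 * |y (j + 3)| - |y (j + 4)|) := by
  rw [coneVec, ← sum_mul_galeEntry (fun i => |y i|) hj]
  simp [mixAbs]

theorem realizable_iff {σ : Fin n → SignType} : Realizable ε n σ ↔
    ∃ y : Fin n → ℝ, (∀ j : Fin n, (j : ℕ) + 4 < n → coneVec ε 0 y j = 0) ∧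
      ∀ i, SignType.sign (y i) = σ i := by
  constructor
  · rintro ⟨y, hy, hσ⟩
    exact ⟨fun i => y i, fun j hj => by rw [coneVec_zero_eq ε y hj, hy j hj], hσ⟩
  · rintro ⟨y, hy, hσ⟩
    let Y : ℕ → ℝ := fun i => if h : i < n then y ⟨i, h⟩ else 0
    have hY : (fun i : Fin n => Y i) = y := funext fun i => by simp [Y]
    refine ⟨Y, fun j hj => ?_, fun i => ?_⟩
    · have := hy ⟨j, by omega⟩ hj
      rwa [← hY, coneVec_zero_eq (j := ⟨j, by omega⟩) ε Y hj] at this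
    · rw [← hσ i, ← hY]

/-- The projection to the last four coordinates, as a continuous linear map. -/
noncomputable def lastFourL (n : ℕ) (hn : 4 ≤ n) :
    EuclideanSpace ℝ (Fin n) →L[ℝ] EuclideanSpace ℝ (Fin 4) :=
  LinearMap.toContinuousLinearMap
    { toFun := lastFour n hn
      map_add' := fun _ _ => rfl
      map_smul' := fun _ _ => rfl }

theorem lastFourL_apply (hn : 4 ≤ n) (x : EuclideanSpace ℝ (Fin n)) (k : Fin 4) :
    lastFourL n hn x k = x ⟨n - 4 + k, by omega⟩ := rfl

theorem lastFourL_eq_zero_iff (hn : 4 ≤ n) {x : EuclideanSpace ℝ (Fin n)} :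
    lastFourL n hn x = 0 ↔ ∀ j : Fin n, n ≤ j + 4 → x j = 0 := by
  constructor
  · intro h j hj
    have := congrArg (fun p : EuclideanSpace ℝ (Fin 4) => p ⟨j - (n - 4), by omega⟩) h
    simp only [lastFourL_apply, PiLp.zero_apply] at this
    rwa [show (⟨n - 4 + (j - (n - 4)), by omega⟩ : Fin n) = j from
      Fin.ext (by simp only; omega)] at this
  · intro h
    ext k
    rw [lastFourL_apply]
    exact h _ (by simp only; omega)

theorem lastFourL_surjective (hn : 4 ≤ n) : Function.Surjective (lastFourL n hn) := fun p => by
  refine ⟨WithLp.toLp 2 fun j => if h : n - 4 ≤ j then p ⟨j - (n - 4), by omega⟩ else 0, ?_⟩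
  ext k
  rw [lastFourL_apply]
  simp

theorem neighborlyCubical_eq (hn : 4 ≤ n) :
    neighborlyCubical n hn ε = lastFourL n hn '' cubeFace n ε 0 := by
  rw [cubeFace_zero]; rfl

theorem exists_comp_lastFourL (hn : 4 ≤ n) {c : Fin n → ℝ}
    (hc : ∀ j : Fin n, (j : ℕ) + 4 < n → c j = 0) :
    ∃ l : EuclideanSpace ℝ (Fin 4) →L[ℝ] ℝ, ∀ x, l (lastFourL n hn x) = coordFunctional c x := by
  refine ⟨coordFunctional fun k => c ⟨n - 4 + k, by omega⟩, fun x => ?_⟩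
  obtain ⟨m, rfl⟩ : ∃ m, n = m + 4 := ⟨n - 4, by omega⟩
  rw [coordFunctional_apply, coordFunctional_apply, Fin.sum_univ_add,
    Finset.sum_eq_zero (s := (Finset.univ : Finset (Fin m))), zero_add]
  · refine Finset.sum_congr rfl fun k _ => ?_
    have h : (⟨m + 4 - 4 + k, by omega⟩ : Fin (m + 4)) = Fin.natAdd m k := Fin.ext (by simp)
    rw [lastFourL_apply, h]
  · intro i _
    rw [hc _ (by simp), zero_mul]

theorem image_argmax {d e : ℕ} (L : EuclideanSpace ℝ (Fin d) →L[ℝ] EuclideanSpace ℝ (Fin e))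
    (l : EuclideanSpace ℝ (Fin e) →L[ℝ] ℝ) (A : Set (EuclideanSpace ℝ (Fin d))) :
    {p ∈ L '' A | ∀ q ∈ L '' A, l q ≤ l p} = L '' {x ∈ A | ∀ z ∈ A, l.comp L z ≤ l.comp L x} := by
  ext p
  constructor
  · rintro ⟨⟨x, hx, rfl⟩, hmax⟩
    exact ⟨x, ⟨hx, fun z hz => hmax _ ⟨z, hz, rfl⟩⟩, rfl⟩
  · rintro ⟨x, ⟨hx, hmax⟩, rfl⟩
    refine ⟨⟨x, hx, rfl⟩, ?_⟩
    rintro _ ⟨z, hz, rfl⟩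
    exact hmax z hz

/-- A parameter for which the projection is neighborly cubical. -/
structure GoodParam (n : ℕ) (ε : ℝ) : Prop extends SmallParam n ε where
  generalPosition : GeneralPosition ε n
  realizable : ∀ σ : Fin n → SignType, (zeroSet σ).card ≤ 1 → Realizable ε n σ

theorem exists_goodParam (n : ℕ) : ∃ e : ℝ, 0 < e ∧ ∀ ε, 0 < ε → ε < e → GoodParam n ε := by
  have h1 : ∀ᶠ ε in 𝓝[>] (0 : ℝ), ε < 1 :=
    (eventually_lt_nhds one_pos).filter_mono nhdsWithin_le_nhds
  have h2 : ∀ᶠ ε : ℝ in 𝓝[>] 0, 12 * n * ε < 1 := by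
    have hc : ContinuousAt (fun ε : ℝ => 12 * n * ε) 0 := by fun_prop
    have h' : ∀ᶠ ε : ℝ in 𝓝 0, 12 * n * ε < 1 := hc.eventually_lt_const (by simp)
    exact h'.filter_mono nhdsWithin_le_nhds
  have h : ∀ᶠ ε in 𝓝[>] (0 : ℝ), GoodParam n ε := by
    filter_upwards [h1, h2, eventually_generalPosition n,
      (eventually_realizable n).filter_mono nhdsWithin_le_nhds, self_mem_nhdsWithin]
      with ε h1 h2 h3 h4 h5
    exact ⟨⟨h5, h1.le, h2.le⟩, h3, h4⟩
  obtain ⟨e, he, hsub⟩ := mem_nhdsGT_iff_exists_Ioo_subset.1 h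
  exact ⟨e, he, fun ε h0 h1 => hsub ⟨h0, h1⟩⟩

/-- The projected faces. -/
def projFace (n : ℕ) (hn : 4 ≤ n) (ε : ℝ) (σ : Fin n → SignType) :
    Set (EuclideanSpace ℝ (Fin 4)) := lastFourL n hn '' cubeFace n ε σ

theorem SmallParam.projFace_nonempty (hε : SmallParam n ε) (hn : 4 ≤ n) (σ : Fin n → SignType) :
    (projFace n hn ε σ).Nonempty := ⟨_, _, hε.cubePoint_mem σ, rfl⟩

/-- The functional belonging to `y` factors through the projection. Points with equal image have
equal value, so the fibre over the projected face adds no points; this is why inclusions among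
projected faces can be read off upstairs. -/
theorem SmallParam.exposed_projFace (hε : SmallParam n ε) (hn : 4 ≤ n) {σ : Fin n → SignType}
    (h : Realizable ε n σ) : IsExposed ℝ (neighborlyCubical n hn ε) (projFace n hn ε σ) ∧
      ∀ x ∈ deformedCube n ε, lastFourL n hn x ∈ projFace n hn ε σ → x ∈ cubeFace n ε σ := by
  obtain ⟨y, hy, hσ⟩ := realizable_iff.1 h
  obtain ⟨l, hl⟩ := exists_comp_lastFourL hn hy
  have hjoin : joinSign 0 y = σ := funext fun i => by simp [joinSign, hσ i]
  have hmax := hε.cubeFace_argmax 0 y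
  have hcomp : coordFunctional (coneVec ε 0 y) = l.comp (lastFourL n hn) := by
    ext x; exact (hl x).symm
  rw [hjoin, hcomp] at hmax
  constructor
  · intro _
    refine ⟨l, ?_⟩
    rw [neighborlyCubical_eq, image_argmax, ← hmax]
    rfl
  · rintro x hx ⟨z, hz, hzx⟩
    rw [hmax] at hz ⊢
    rw [cubeFace_zero] at hz ⊢
    refine ⟨hx, fun w hw => ?_⟩
    have := hz.2 w hw
    simp only [ContinuousLinearMap.comp_apply] at this ⊢
    rwa [← hzx]

/-- A functional on `ℝ^4` is pulled back and maximized upstairs. For `σ = 0` its coefficient vector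
vanishes at the first `n - 4` places, which is realizability. -/
theorem SmallParam.exists_eq_projFace (hε : SmallParam n ε) (hn : 4 ≤ n) (σ : Fin n → SignType)
    {G : Set (EuclideanSpace ℝ (Fin 4))} (hG : IsExposed ℝ (projFace n hn ε σ) G)
    (hne : G.Nonempty) : ∃ τ, Conforms σ τ ∧ G = projFace n hn ε τ ∧ (σ = 0 → Realizable ε n τ) := by
  obtain ⟨l, rfl⟩ := hG hne
  obtain ⟨y, hy, hmax⟩ := hε.exists_argmax_eq σ (l.comp (lastFourL n hn))
  refine ⟨joinSign σ y, conforms_joinSign σ y, ?_, ?_⟩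
  · rw [projFace, image_argmax, hmax]
    rfl
  · rintro rfl
    refine realizable_iff.2 ⟨y, fun j hj => ?_, fun i => by simp [joinSign]⟩
    have h1 : lastFourL n hn (EuclideanSpace.single j 1) = 0 := by
      rw [lastFourL_eq_zero_iff]
      intro i hi
      have : i ≠ j := by rintro rfl; omega
      simp [this]
    have h2 := congrArg (fun f => f (EuclideanSpace.single j 1)) hy
    simp only [ContinuousLinearMap.comp_apply, h1, map_zero, coordFunctional_apply] at h2
    simpa using h2.symm

theorem SmallParam.exists_eq_projFace_of_exposed (hε : SmallParam n ε) (hn : 4 ≤ n)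
    {G : Set (EuclideanSpace ℝ (Fin 4))} (hG : IsExposed ℝ (neighborlyCubical n hn ε) G)
    (hne : G.Nonempty) : ∃ τ, Realizable ε n τ ∧ G = projFace n hn ε τ := by
  rw [neighborlyCubical_eq] at hG
  obtain ⟨τ, _, h1, h2⟩ := hε.exists_eq_projFace hn 0 hG hne
  exact ⟨τ, h2 rfl, h1⟩

theorem SmallParam.projFace_subset_iff (hε : SmallParam n ε) (hn : 4 ≤ n)
    {σ τ : Fin n → SignType} (hτ : Realizable ε n τ) :
    projFace n hn ε σ ⊆ projFace n hn ε τ ↔ Conforms τ σ := by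
  rw [← hε.cubeFace_subset_iff]
  refine ⟨fun h x hx => (hε.exposed_projFace hn hτ).2 x hx.1 (h ⟨x, hx, rfl⟩), Set.image_mono⟩

theorem SmallParam.projFace_injective (hε : SmallParam n ε) (hn : 4 ≤ n)
    {σ τ : Fin n → SignType} (hσ : Realizable ε n σ) (hτ : Realizable ε n τ)
    (h : projFace n hn ε σ = projFace n hn ε τ) : σ = τ :=
  ((hε.projFace_subset_iff hn hσ).1 h.symm.subset).antisymm
    ((hε.projFace_subset_iff hn hτ).1 h.subset)

/-- The free signs of `σ` are replaced by those of `ρ`. -/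
def fillFree (σ : Fin n → SignType) (ρ : {i // σ i = 0} → SignType) (i : Fin n) : SignType :=
  if h : σ i = 0 then ρ ⟨i, h⟩ else σ i

theorem conforms_fillFree (σ : Fin n → SignType) (ρ : {i // σ i = 0} → SignType) :
    Conforms σ (fillFree σ ρ) := fun _ hi => dif_neg hi

theorem conforms_fillFree_iff (σ : Fin n → SignType) (ρ ρ' : {i // σ i = 0} → SignType) :
    Conforms (fillFree σ ρ) (fillFree σ ρ') ↔ Conforms ρ ρ' := by
  constructor
  · rintro h ⟨i, hi⟩ h0
    have := h i
    simp only [fillFree, hi, dite_true] at this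
    exact this h0
  · intro h i
    by_cases hi : σ i = 0
    · simp only [fillFree, hi, dite_true]
      exact h ⟨i, hi⟩
    · simp [fillFree, hi]

theorem GoodParam.isCubeParam_projFace (hε : GoodParam n ε) (hn : 4 ≤ n) {σ : Fin n → SignType}
    (hσ : Realizable ε n σ) (h0 : σ ≠ 0) :
    IsCubeParam (projFace n hn ε σ) fun ρ => projFace n hn ε (fillFree σ ρ) := by
  have hreal : ∀ ρ, Realizable ε n (fillFree σ ρ) := fun ρ =>
    hσ.of_conforms hε.generalPosition hn h0 (conforms_fillFree σ ρ)
  refine ⟨fun ρ => ?_, fun ρ => hε.projFace_nonempty hn _, fun G hG hne => ?_, fun ρ ρ' => ?_⟩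
  · exact (hε.exposed_projFace hn (hreal ρ)).1.mono (hε.exposed_projFace hn hσ).1.subset
      ((hε.projFace_subset_iff hn hσ).2 (conforms_fillFree σ ρ))
  · obtain ⟨τ, hc, rfl, _⟩ := hε.exists_eq_projFace hn σ hG hne
    refine ⟨fun i => τ i, congrArg _ (funext fun i => ?_)⟩
    by_cases hi : σ i = 0
    · simp [fillFree, hi]
    · rw [hc i hi]; simp [fillFree, hi]
  · rw [hε.projFace_subset_iff hn (hreal ρ'), conforms_fillFree_iff]

/-- The projection is injective on the proper faces that it preserves. -/
theorem GoodParam.eq_zero_of_mem_faceDir (hε : GoodParam n ε) (hn : 4 ≤ n)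
    {σ : Fin n → SignType} (hσ : Realizable ε n σ) (h0 : σ ≠ 0) {d : EuclideanSpace ℝ (Fin n)}
    (hd : d ∈ faceDir ε σ) (hd0 : lastFourL n hn d = 0) : d = 0 := by
  rw [lastFourL_eq_zero_iff] at hd0
  set S : Fin n → SignType := fun i => if σ i = 0 then 1 else σ i with hS
  have hSσ : Conforms σ S := fun _ hi => if_neg hi
  have hS0 : ∀ i, S i ≠ 0 := fun i => by
    simp only [hS]
    split_ifs with h
    · decide
    · exact h
  obtain ⟨s, hs⟩ := exists_fills S
  have hsS : ∀ i : Fin n, s i = S i := fun i => hs.2 i (hS0 i)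
  -- The direction `d` itself is used as a functional; evaluating it at `d` gives the sum of
  -- squares. With all signs fixed by `S`, `coneVec` is linear in its argument.
  obtain ⟨y, hy⟩ := exists_coneVec_eq hε.pos.ne' S fun j => d j
  have hle := hσ.card_zeroSet_le hε.generalPosition h0
  -- The vector `z` is to agree with `y` at the at most three zeros of `σ` while `coneVec ε S z`
  -- vanishes at the first `n - 4` places.
  obtain ⟨v, hv⟩ := hε.generalPosition.exists_eq hn hs.1 (zeroIdx_subset σ)
    (by rw [card_zeroIdx]; omega) fun i => if h : i < n then s i * y ⟨i, h⟩ else 0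
  rw [forall_mem_zeroIdx] at hv
  set z : Fin n → ℝ := fun i => (S i : ℝ) * recSol ε s v i with hz
  have hSS : ∀ i, (S i : ℝ) * S i = 1 := fun i => sign_cast_mul_self (hS0 i)
  have hcone : ∀ w j, coneVec ε S w j = ε * w j + ∑ i, S i * w i * galeEntry n i j := fun w j => by
    simp [coneVec, mixAbs, hS0]
  have hzc : ∀ j : Fin n, (j : ℕ) + 4 < n → coneVec ε S z j = 0 := by
    intro j hj
    rw [hcone]
    have h1 : ∀ i : Fin n, S i * z i * galeEntry n i j = recSol ε s v i * galeEntry n i j :=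
      fun i => by rw [hz, ← mul_assoc, hSS, one_mul]
    simp only [h1]
    have hzj : z j = s j * recSol ε s v j := by rw [hsS]
    rw [sum_mul_galeEntry (recSol ε s v) hj, hzj, recSol]
    ring
  have hyz : ∀ i, σ i = 0 → y i = z i := fun i hi => by
    have := hv i hi
    simp only [i.isLt, dite_true, Fin.eta] at this
    rw [hz]
    simp only
    rw [this, hsS, ← mul_assoc, hSS, one_mul]
  -- Only signed rows of `σ` remain in `y - z`, and these annihilate `d`.
  have hsum : ∑ j, coneVec ε S (y - z) j * d j = 0 := by
    rw [← coordFunctional_apply, coordFunctional_coneVec]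
    refine Finset.sum_eq_zero fun i _ => ?_
    simp only [mixAbs, hS0, if_false, Pi.sub_apply]
    by_cases hi : σ i = 0
    · rw [hyz i hi]; ring
    · have h1 := hd i hi
      rw [← hSσ i hi] at h1
      linear_combination (S i * (y i - z i)) * h1 - ε * (y i - z i) * d i * hSS i
  have hsub : ∀ j, coneVec ε S (y - z) j = coneVec ε S y j - coneVec ε S z j := fun j => by
    rw [hcone, hcone, hcone]
    have : ∀ i, S i * (y - z) i * galeEntry n i j
        = S i * y i * galeEntry n i j - S i * z i * galeEntry n i j := fun i => by
      rw [Pi.sub_apply]; ring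
    rw [Finset.sum_congr rfl fun i _ => this i, Finset.sum_sub_distrib, Pi.sub_apply]
    ring
  -- The functional of `y - z` agrees with `d` at the first `n - 4` places, and `d` is zero at the
  -- last four.
  have hsq : ∑ j, d j * d j = 0 := by
    rw [← hsum]
    refine Finset.sum_congr rfl fun j _ => ?_
    by_cases hj : (j : ℕ) + 4 < n
    · rw [hsub, hy, hzc j hj, sub_zero]
    · rw [hd0 j (by omega)]; ring
  ext j
  have := (Finset.sum_eq_zero_iff_of_nonneg fun j _ => mul_self_nonneg (d j)).1 hsq j
    (Finset.mem_univ j)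
  simpa using this

theorem SmallParam.vectorSpan_projFace (hε : SmallParam n ε) (hn : 4 ≤ n)
    (σ : Fin n → SignType) : vectorSpan ℝ (projFace n hn ε σ)
      = (faceDir ε σ).map (lastFourL n hn).toLinearMap := by
  rw [← hε.vectorSpan_cubeFace σ]
  exact (AffineMap.map_vectorSpan
    (lastFourL n hn).toLinearMap.toAffineMap).symm

theorem GoodParam.affDim_projFace (hε : GoodParam n ε) (hn : 4 ≤ n) {σ : Fin n → SignType}
    (hσ : Realizable ε n σ) (h0 : σ ≠ 0) :
    affDim (projFace n hn ε σ) = (zeroSet σ).card := by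
  rw [affDim, hε.vectorSpan_projFace, ← LinearMap.range_domRestrict,
    LinearMap.finrank_range_of_inj, finrank_faceDir hε.pos.ne']
  rw [← LinearMap.ker_eq_bot, LinearMap.ker_eq_bot']
  rintro ⟨d, hd⟩ h
  rw [Submodule.mk_eq_zero]
  exact hε.eq_zero_of_mem_faceDir hn hσ h0 hd h

theorem SmallParam.affDim_neighborlyCubical (hε : SmallParam n ε) (hn : 4 ≤ n) :
    affDim (neighborlyCubical n hn ε) = 4 := by
  have h1 : faceDir ε (0 : Fin n → SignType) = ⊤ := by
    rw [eq_top_iff]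
    intro d _ i hi
    exact absurd rfl hi
  have h2 := hε.vectorSpan_projFace hn 0
  rw [h1, Submodule.map_top, LinearMap.range_eq_top.2 (lastFourL_surjective hn)] at h2
  rw [affDim, neighborlyCubical_eq]
  change Module.finrank ℝ (vectorSpan ℝ (projFace n hn ε 0)) = 4
  rw [h2, finrank_top, finrank_euclideanSpace_fin]

theorem SmallParam.neighborlyCubical_eq_convexHull (hε : SmallParam n ε) (hn : 4 ≤ n) :
    neighborlyCubical n hn ε = convexHull ℝ
      ((fun σ => lastFourL n hn (cubePoint n ε σ)) '' {ρ | ∀ i, ρ i ≠ 0}) := by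
  rw [neighborlyCubical_eq, hε.cubeFace_eq_convexHull]
  have : {ρ : Fin n → SignType | Conforms 0 ρ ∧ ∀ i, ρ i ≠ 0} = {ρ | ∀ i, ρ i ≠ 0} := by
    ext ρ
    exact ⟨fun h => h.2, fun h => ⟨fun i hi => absurd rfl hi, h⟩⟩
  rw [this]
  refine ((lastFourL n hn).toLinearMap.image_convexHull _).trans ?_
  rw [Set.image_image]
  rfl

theorem SmallParam.isFullPolytope_neighborlyCubical (hε : SmallParam n ε) (hn : 4 ≤ n) :
    IsFullPolytope (neighborlyCubical n hn ε) := by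
  have hfin : ((fun σ => lastFourL n hn (cubePoint n ε σ)) ''
      {ρ : Fin n → SignType | ∀ i, ρ i ≠ 0}).Finite := Set.toFinite _
  refine ⟨⟨hfin.toFinset, ?_⟩, ?_, hε.affDim_neighborlyCubical hn⟩
  · rw [hfin.coe_toFinset, hε.neighborlyCubical_eq_convexHull hn]
  · rw [neighborlyCubical_eq]
    exact hε.projFace_nonempty hn 0

theorem SmallParam.exists_eq_of_mem_extremePoints (hε : SmallParam n ε) (hn : 4 ≤ n)
    {p : EuclideanSpace ℝ (Fin 4)} (hp : p ∈ (neighborlyCubical n hn ε).extremePoints ℝ) :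
    ∃ σ : Fin n → SignType, (∀ i, σ i ≠ 0) ∧ lastFourL n hn (cubePoint n ε σ) = p := by
  rw [hε.neighborlyCubical_eq_convexHull hn] at hp
  obtain ⟨σ, hσ, h⟩ := extremePoints_convexHull_subset hp
  exact ⟨σ, hσ, h⟩

theorem SmallParam.isRational_neighborlyCubical {q : ℚ} (hε : SmallParam n q) (hn : 4 ≤ n) :
    IsRational (neighborlyCubical n hn q) := by
  intro p hp k
  obtain ⟨σ, hσ, rfl⟩ := hε.exists_eq_of_mem_extremePoints hn hp
  exact hε.cubePoint_rational hσ _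

theorem GoodParam.isCubical_neighborlyCubical (hε : GoodParam n ε) (hn : 4 ≤ n) :
    IsCubical (neighborlyCubical n hn ε) := by
  intro F hF hne hproper
  obtain ⟨τ, hτ, rfl⟩ := hε.exists_eq_projFace_of_exposed hn hF hne
  have h0 : τ ≠ 0 := by
    rintro rfl
    exact hproper (neighborlyCubical_eq hn).symm
  rw [hε.affDim_projFace hn hτ h0]
  refine ((hε.isCubeParam_projFace hn hτ h0).reindex (Fintype.equivFinOfCardEq ?_)).combEquiv
    (isCubeParam_stdCube _)
  rw [Fintype.card_subtype]
  rfl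

theorem combEquiv_deformedCube (hε : SmallParam n ε) : CombEquiv (deformedCube n ε) (stdCube n) :=
  hε.isCubeParam_deformedCube.combEquiv (isCubeParam_stdCube n)

/-! ### The flag-vector -/

theorem GoodParam.isKFace_iff (hε : GoodParam n ε) (hn : 4 ≤ n) {k : ℕ} (hk : k < 4)
    {F : Set (EuclideanSpace ℝ (Fin 4))} : IsKFace (neighborlyCubical n hn ε) k F ↔
      ∃ σ ∈ realizableSet ε n, (zeroSet σ).card = k ∧ projFace n hn ε σ = F := by
  constructor
  · rintro ⟨hF, hne, hdim⟩
    obtain ⟨τ, hτ, rfl⟩ := hε.exists_eq_projFace_of_exposed hn hF hne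
    have h0 : τ ≠ 0 := by
      rintro rfl
      have h4 := hε.affDim_neighborlyCubical hn
      rw [neighborlyCubical_eq] at h4
      exact hk.ne (hdim.symm.trans h4)
    exact ⟨τ, mem_realizableSet.2 ⟨hτ, h0⟩, (hε.affDim_projFace hn hτ h0).symm.trans hdim, rfl⟩
  · rintro ⟨σ, hσ, hc, rfl⟩
    obtain ⟨hσ, h0⟩ := mem_realizableSet.1 hσ
    exact ⟨(hε.exposed_projFace hn hσ).1, hε.projFace_nonempty hn σ,
      (hε.affDim_projFace hn hσ h0).trans hc⟩

theorem GoodParam.faceNumber_eq (hε : GoodParam n ε) (hn : 4 ≤ n) {k : ℕ} (hk : k < 4) :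
    faceNumber (neighborlyCubical n hn ε) k = realizableCount ε n k := by
  have h : {F | IsKFace (neighborlyCubical n hn ε) k F} = projFace n hn ε ''
      ((realizableSet ε n).filter fun σ => (zeroSet σ).card = k : Finset (Fin n → SignType)) := by
    ext F
    simp only [Set.mem_ofPred_eq, hε.isKFace_iff hn hk, Set.mem_image, Finset.coe_filter, and_assoc]
  rw [faceNumber, h, Set.InjOn.ncard_image, Set.ncard_coe_finset, realizableCount]
  intro σ hσ τ hτ hστ
  rw [Finset.mem_coe, Finset.mem_filter, mem_realizableSet] at hσ hτ
  exact hε.projFace_injective hn hσ.1.1 hτ.1.1 hστ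

/-- A facet is given by a vector with three zeros; its vertices are the `2 ^ 3` ways to fill them,
all of which are realizable. -/
theorem GoodParam.flagNumber_eq (hε : GoodParam n ε) (hn : 4 ≤ n) :
    flagNumber (neighborlyCubical n hn ε) 0 3 = 8 * realizableCount ε n 3 := by
  classical
  let T : Finset ((_ : Fin n → SignType) × (Fin n → SignType)) :=
    ((realizableSet ε n).filter fun τ => (zeroSet τ).card = 3).sigma fun τ =>
      (realizableSet ε n).filter fun σ => (zeroSet σ).card = 0 ∧ Conforms τ σ
  have hT : ∀ τ σ, (⟨τ, σ⟩ : (_ : Fin n → SignType) × (Fin n → SignType)) ∈ T ↔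
      ((Realizable ε n τ ∧ τ ≠ 0) ∧ (zeroSet τ).card = 3) ∧
        (Realizable ε n σ ∧ σ ≠ 0) ∧ (zeroSet σ).card = 0 ∧ Conforms τ σ := fun τ σ => by
    simp only [T, Finset.mem_sigma, Finset.mem_filter, mem_realizableSet]
  have h : {p : Set (EuclideanSpace ℝ (Fin 4)) × Set (EuclideanSpace ℝ (Fin 4)) |
      IsKFace (neighborlyCubical n hn ε) 0 p.1 ∧ IsKFace (neighborlyCubical n hn ε) 3 p.2 ∧
        p.1 ⊆ p.2} = (fun q : (_ : Fin n → SignType) × (Fin n → SignType) =>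
          (projFace n hn ε q.2, projFace n hn ε q.1)) '' (T : Set _) := by
    ext ⟨F, G⟩
    simp only [Set.mem_ofPred_eq, hε.isKFace_iff hn (show 0 < 4 by norm_num),
      hε.isKFace_iff hn (show 3 < 4 by norm_num), Set.mem_image, Finset.mem_coe, Prod.mk.injEq]
    constructor
    · rintro ⟨⟨σ, hσ, hσ0, rfl⟩, ⟨τ, hτ, hτ3, rfl⟩, hsub⟩
      rw [mem_realizableSet] at hσ hτ
      exact ⟨⟨τ, σ⟩, (hT τ σ).2 ⟨⟨hτ, hτ3⟩, hσ, hσ0, (hε.projFace_subset_iff hn hτ.1).1 hsub⟩,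
        rfl, rfl⟩
    · rintro ⟨⟨τ, σ⟩, hq, rfl, rfl⟩
      obtain ⟨⟨hτ, hτ3⟩, hσ, hσ0, hc⟩ := (hT τ σ).1 hq
      exact ⟨⟨σ, mem_realizableSet.2 hσ, hσ0, rfl⟩, ⟨τ, mem_realizableSet.2 hτ, hτ3, rfl⟩,
        (hε.projFace_subset_iff hn hτ.1).2 hc⟩
  rw [flagNumber, h, Set.InjOn.ncard_image, Set.ncard_coe_finset, Finset.card_sigma,
    Finset.sum_congr rfl (g := fun _ => 8), Finset.sum_const, smul_eq_mul, mul_comm]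
  · rfl
  · intro τ hτ
    rw [Finset.mem_filter, mem_realizableSet] at hτ
    have h8 := card_full_conforms τ
    rw [hτ.2] at h8
    change _ = 2 ^ 3
    rw [← h8]
    congr 1
    ext σ
    simp only [Finset.mem_filter, mem_realizableSet, Finset.mem_univ, true_and,
      Finset.card_eq_zero, Finset.eq_empty_iff_forall_notMem, mem_zeroSet]
    exact ⟨fun h => ⟨h.2.2, h.2.1⟩, fun h => ⟨⟨hτ.1.1.of_conforms hε.generalPosition hn hτ.1.2 h.1,
      h.1.ne_zero hτ.1.2⟩, h.2, h.1⟩⟩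
  · rintro ⟨τ, σ⟩ hq ⟨τ', σ'⟩ hq' heq
    obtain ⟨⟨hτ, _⟩, hσ, _⟩ := (hT τ σ).1 hq
    obtain ⟨⟨hτ', _⟩, hσ', _⟩ := (hT τ' σ').1 hq'
    simp only [Prod.mk.injEq] at heq
    rw [hε.projFace_injective hn hσ.1 hσ'.1 heq.1, hε.projFace_injective hn hτ.1 hτ'.1 heq.2]

theorem GoodParam.flagVector_eq (hε : GoodParam n ε) (hn : 4 ≤ n) :
    flagVector (neighborlyCubical n hn ε) =
      (4 * 2 ^ (n - 2), 2 * n * 2 ^ (n - 2), 3 * (n - 2) * 2 ^ (n - 2),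
        (n - 2) * 2 ^ (n - 2), 8 * (n - 2) * 2 ^ (n - 2)) := by
  obtain ⟨h0, h1, h2, h3⟩ := realizableCount_eq hε.pos.ne' hn hε.generalPosition hε.realizable
  rw [flagVector, hε.faceNumber_eq hn (by norm_num), hε.faceNumber_eq hn (by norm_num),
    hε.faceNumber_eq hn (by norm_num), hε.faceNumber_eq hn (by norm_num), hε.flagNumber_eq hn,
    h0, h1, h2, h3, mul_assoc 8]

/-! ### The graph -/

/-- The sign vector without zeros given by a 0/1-string. -/
def boolSign (a : Fin n → Bool) (i : Fin n) : SignType := if a i then 1 else -1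

theorem boolSign_ne_zero (a : Fin n → Bool) (i : Fin n) : boolSign a i ≠ 0 := by
  unfold boolSign; cases a i <;> decide

theorem boolSign_eq_iff (a b : Fin n → Bool) (i : Fin n) :
    boolSign a i = boolSign b i ↔ a i = b i := by
  unfold boolSign; cases a i <;> cases b i <;> decide

theorem exists_boolSign_eq {σ : Fin n → SignType} (hσ : ∀ i, σ i ≠ 0) :
    ∃ a, boolSign a = σ := by
  refine ⟨fun i => σ i = 1, funext fun i => ?_⟩
  have h : ∀ t : SignType, t ≠ 0 → (if decide (t = 1) = true then 1 else -1) = t := by decide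
  exact h _ (hσ i)

theorem zeroSet_boolSign (a : Fin n → Bool) : (zeroSet (boolSign a)).card = 0 := by
  rw [Finset.card_eq_zero, Finset.eq_empty_iff_forall_notMem]
  exact fun i hi => boolSign_ne_zero a i (mem_zeroSet.1 hi)

/-- The vertex of the projected polytope with given signs. -/
noncomputable def projVertex (n : ℕ) (hn : 4 ≤ n) (ε : ℝ) (a : Fin n → Bool) :
    EuclideanSpace ℝ (Fin 4) := lastFourL n hn (cubePoint n ε (boolSign a))

theorem GoodParam.projVertex_mem_iff (hε : GoodParam n ε) (hn : 4 ≤ n) (a : Fin n → Bool)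
    {τ : Fin n → SignType} (hτ : Realizable ε n τ) :
    projVertex n hn ε a ∈ projFace n hn ε τ ↔ Conforms τ (boolSign a) := by
  rw [← hε.cubePoint_mem_iff]
  exact ⟨(hε.exposed_projFace hn hτ).2 _ (hε.cubePoint_mem _).1, fun h => ⟨_, h, rfl⟩⟩

theorem GoodParam.projVertex_mem_extremePoints (hε : GoodParam n ε) (hn : 4 ≤ n)
    (a : Fin n → Bool) :
    projVertex n hn ε a ∈ (neighborlyCubical n hn ε).extremePoints ℝ := by
  apply exposedPoints_subset_extremePoints
  rw [mem_exposedPoints_iff_exposed_singleton]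
  have h := (hε.exposed_projFace hn
    (hε.realizable (boolSign a) (by rw [zeroSet_boolSign]; norm_num))).1
  rwa [projFace, hε.cubeFace_eq_singleton (boolSign_ne_zero a), Set.image_singleton] at h

theorem GoodParam.projVertex_injective (hε : GoodParam n ε) (hn : 4 ≤ n) :
    Function.Injective (projVertex n hn ε) := by
  intro a b hab
  have hb := hε.realizable (boolSign b) (by rw [zeroSet_boolSign]; norm_num)
  have h := (hε.projVertex_mem_iff hn b hb).2 (Conforms.refl _)
  rw [← hab, hε.projVertex_mem_iff hn a hb] at h
  exact funext fun i => (boolSign_eq_iff a b i).1 (h i (boolSign_ne_zero b i))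

/-- An exposed segment is a projected face whose vertices are extreme points on the segment, hence
endpoints; so `2 ^ k ≤ 2` for its number `k` of zeros. Conversely, zeroing the single differing sign
leaves one zero, and neighborliness makes that edge a face. -/
theorem GoodParam.exposed_segment_iff (hε : GoodParam n ε) (hn : 4 ≤ n) (a b : Fin n → Bool) :
    (projVertex n hn ε a ≠ projVertex n hn ε b ∧ IsExposed ℝ (neighborlyCubical n hn ε)
      (segment ℝ (projVertex n hn ε a) (projVertex n hn ε b))) ↔ hammingDist a b = 1 := by
  classical
  constructor
  · rintro ⟨hne, hexp⟩
    obtain ⟨τ, hτ, hseg⟩ := hε.exists_eq_projFace_of_exposed hn hexp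
      ⟨_, left_mem_segment ℝ _ _⟩
    have hca : Conforms τ (boolSign a) := by
      rw [← hε.projVertex_mem_iff hn a hτ, ← hseg]; exact left_mem_segment ℝ _ _
    have hcb : Conforms τ (boolSign b) := by
      rw [← hε.projVertex_mem_iff hn b hτ, ← hseg]; exact right_mem_segment ℝ _ _
    have hsub : (Finset.univ.filter fun σ : Fin n → SignType => Conforms τ σ ∧ ∀ i, σ i ≠ 0)
        ⊆ {boolSign a, boolSign b} := by
      intro σ hσ
      obtain ⟨hc, hfull⟩ := (Finset.mem_filter.1 hσ).2
      obtain ⟨c, rfl⟩ := exists_boolSign_eq hfull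
      have hmem := (hε.projVertex_mem_iff hn c hτ).2 hc
      rw [← hseg] at hmem
      have hext := mem_extremePoints_iff_forall_segment.1
        (hε.projVertex_mem_extremePoints hn c)
      rw [Finset.mem_insert, Finset.mem_singleton]
      rcases hext.2 _ (hε.projVertex_mem_extremePoints hn a).1 _
        (hε.projVertex_mem_extremePoints hn b).1 hmem with h | h
      · exact Or.inl (congrArg boolSign (hε.projVertex_injective hn h).symm)
      · exact Or.inr (congrArg boolSign (hε.projVertex_injective hn h).symm)
    have hcard := (Finset.card_le_card hsub).trans Finset.card_le_two
    rw [card_full_conforms] at hcard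
    have hz : (zeroSet τ).card ≤ 1 := by
      by_contra h
      have : 2 ^ 2 ≤ 2 ^ (zeroSet τ).card := Nat.pow_le_pow_right (by norm_num) (by omega)
      omega
    have hdist : hammingDist a b ≤ (zeroSet τ).card := by
      refine Finset.card_le_card fun i hi => ?_
      rw [mem_zeroSet]
      by_contra h0
      exact (Finset.mem_filter.1 hi).2
        ((boolSign_eq_iff a b i).1 ((hca i h0).trans (hcb i h0).symm))
    have hpos : 0 < hammingDist a b := hammingDist_pos.2 fun h => hne (by rw [h])
    omega
  · intro hdist
    have hne : a ≠ b := by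
      rintro rfl
      simp at hdist
    refine ⟨fun h => hne (hε.projVertex_injective hn h), ?_⟩
    obtain ⟨i, hi⟩ := Finset.card_eq_one.1 hdist
    have hab : ∀ j, a j ≠ b j ↔ j = i := fun j => by
      rw [← Finset.mem_singleton, ← hi]; simp
    set τ := Function.update (boolSign a) i 0 with hτdef
    have hτ : Realizable ε n τ := by
      refine hε.realizable τ ?_
      rw [hτdef, zeroSet_update_zero]
      refine (Finset.card_insert_le _ _).trans ?_
      rw [zeroSet_boolSign]
    have hset : {ρ : Fin n → SignType | Conforms τ ρ ∧ ∀ i, ρ i ≠ 0}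
        = {boolSign a, boolSign b} := by
      have hτj : ∀ j, j ≠ i → τ j = boolSign a j := fun j hj => Function.update_of_ne hj _ _
      have hτi : τ i = 0 := Function.update_self _ _ _
      ext ρ
      rw [Set.mem_insert_iff, Set.mem_singleton_iff, Set.mem_ofPred_eq]
      constructor
      · rintro ⟨hc, hfull⟩
        obtain ⟨c, rfl⟩ := exists_boolSign_eq hfull
        have hcj : ∀ j, j ≠ i → c j = a j := fun j hj => (boolSign_eq_iff c a j).1 (by
          rw [← hτj j hj]
          exact hc j (by rw [hτj j hj]; exact boolSign_ne_zero a j))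
        by_cases hci : c i = a i
        · left
          congr 1
          funext j
          by_cases hj : j = i
          · rw [hj, hci]
          · exact hcj j hj
        · right
          congr 1
          funext j
          by_cases hj : j = i
          · subst hj
            have := (hab j).2 rfl
            revert hci this
            cases c j <;> cases a j <;> cases b j <;> decide
          · rw [hcj j hj]
            by_contra h
            exact hj ((hab j).1 h)
      · have hca : Conforms τ (boolSign a) := conforms_update_zero _ _
        rintro (rfl | rfl)
        · exact ⟨hca, boolSign_ne_zero a⟩
        · refine ⟨fun j hj => ?_, boolSign_ne_zero b⟩
          have hji : j ≠ i := fun h => hj (by rw [h, hτi])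
          rw [← hca j hj, boolSign_eq_iff]
          by_contra h
          exact hji ((hab j).1 fun h' => h h'.symm)
    have hface : projFace n hn ε τ
        = segment ℝ (projVertex n hn ε a) (projVertex n hn ε b) := by
      rw [projFace, hε.cubeFace_eq_convexHull, hset, Set.image_pair, convexHull_pair]
      exact image_segment ℝ (lastFourL n hn).toLinearMap.toAffineMap _ _
    rw [← hface]
    exact (hε.exposed_projFace hn hτ).1

theorem GoodParam.nonempty_graph_iso (hε : GoodParam n ε) (hn : 4 ≤ n) :
    Nonempty (polytopeGraph (neighborlyCubical n hn ε) ≃g cubeGraph n) := by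
  let φ : (Fin n → Bool) → (neighborlyCubical n hn ε).extremePoints ℝ := fun a =>
    ⟨projVertex n hn ε a, hε.projVertex_mem_extremePoints hn a⟩
  have hφ : Function.Bijective φ := by
    constructor
    · exact fun a b hab => hε.projVertex_injective hn (congrArg Subtype.val hab)
    · rintro ⟨p, hp⟩
      obtain ⟨σ, hσ, rfl⟩ := hε.exists_eq_of_mem_extremePoints hn hp
      obtain ⟨a, rfl⟩ := exists_boolSign_eq hσ
      exact ⟨a, rfl⟩
  refine ⟨SimpleGraph.Iso.symm ⟨Equiv.ofBijective φ hφ, ?_⟩⟩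
  intro a b
  refine Iff.trans ?_ (hε.exposed_segment_iff hn a b)
  change φ a ≠ φ b ∧ _ ↔ _
  rw [Ne, Subtype.ext_iff]
  rfl

/-! ### Asymptotics and the main theorem -/

theorem GoodParam.abs_fatness_complexity_le (hε : GoodParam n ε) (hn : 4 ≤ n) :
    |fatness (neighborlyCubical n hn ε) - 5| ≤ 40 / n ∧
      |complexity (neighborlyCubical n hn ε) - 8| ≤ 40 / n := by
  have h := hε.flagVector_eq hn
  simp only [flagVector, Prod.mk.injEq] at h
  obtain ⟨h0, h1, h2, h3, h4⟩ := h
  rw [fatness, complexity, h0, h1, h2, h3, h4]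
  obtain ⟨m, rfl⟩ : ∃ m, n = m + 2 := ⟨n - 2, by omega⟩
  simp only [Nat.add_sub_cancel]
  push_cast
  have hm : (2 : ℝ) ≤ m := by exact_mod_cast (by omega : 2 ≤ m)
  have hu : (4 : ℝ) ≤ 2 ^ m := by
    calc (4 : ℝ) = 2 ^ 2 := by norm_num
      _ ≤ 2 ^ m := pow_le_pow_right₀ (by norm_num) (by omega)
  set u : ℝ := 2 ^ m
  have hden : (m + 2) * u / 2 ≤ 4 * u + m * u - 10 := by nlinarith
  have hn0 : 0 < (m + 2 : ℝ) * u / 2 := by positivity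
  have hden0 : 0 < 4 * u + m * u - 10 := lt_of_lt_of_le hn0 hden
  constructor
  · rw [div_sub' hden0.ne', abs_div, abs_of_pos hden0, div_le_div_iff₀ hden0 (by positivity)]
    -- The terms in `m * u` cancel: this numerator is `-16 u + 30`, and the one for complexity is
    -- `-32 u + 60`, against a denominator of order `m * u`.
    have h5 : |2 * (m + 2) * u + 3 * m * u - 20 - (4 * u + m * u - 10) * 5| ≤ 20 * u := by
      rw [abs_le]; constructor <;> nlinarith
    nlinarith
  · rw [div_sub' hden0.ne', abs_div, abs_of_pos hden0, div_le_div_iff₀ hden0 (by positivity)]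
    have h5 : |8 * m * u - 20 - (4 * u + m * u - 10) * 8| ≤ 32 * u := by
      rw [abs_le]; constructor <;> nlinarith
    nlinarith

end Projection

end PolytopeFaces

theorem mainTheorem6 :
    ∃ ε₀ : ℕ → ℝ, (∀ n, 0 < ε₀ n) ∧
      (∀ (n : ℕ) (hn : 4 ≤ n) (ε : ℚ), 0 < ε → (ε : ℝ) < ε₀ n →
        IsPolytope (deformedCube n ε) ∧
        CombEquiv (deformedCube n ε) (stdCube n) ∧
        IsFullPolytope (neighborlyCubical n hn ε) ∧
        IsRational (neighborlyCubical n hn ε) ∧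
        IsCubical (neighborlyCubical n hn ε) ∧
        Nonempty (polytopeGraph (neighborlyCubical n hn ε) ≃g cubeGraph n) ∧
        flagVector (neighborlyCubical n hn ε) =
          (4 * 2 ^ (n - 2), 2 * n * 2 ^ (n - 2), 3 * (n - 2) * 2 ^ (n - 2),
            (n - 2) * 2 ^ (n - 2), 8 * (n - 2) * 2 ^ (n - 2))) ∧
      (∀ δ : ℝ, 0 < δ → ∃ N : ℕ, ∀ (n : ℕ) (hn : 4 ≤ n), N ≤ n →
        ∀ ε : ℚ, 0 < ε → (ε : ℝ) < ε₀ n →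
          |fatness (neighborlyCubical n hn ε) - 5| < δ ∧
          |complexity (neighborlyCubical n hn ε) - 8| < δ) ∧
      (∀ δ : ℝ, 0 < δ → ∃ P : Set (EuclideanSpace ℝ (Fin 4)),
        IsFullPolytope P ∧ IsRational P ∧ |fatness P - 5| < δ ∧ |complexity P - 8| < δ) := by
  choose ε₀ hpos hgood using exists_goodParam
  have hparam : ∀ (n : ℕ) (ε : ℚ), 0 < ε → (ε : ℝ) < ε₀ n → GoodParam n ε := fun n ε h0 h1 =>
    hgood n ε (by exact_mod_cast h0) h1
  have hlim : ∀ δ : ℝ, 0 < δ → ∃ N : ℕ, ∀ (n : ℕ) (hn : 4 ≤ n), N ≤ n →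
      ∀ ε : ℚ, 0 < ε → (ε : ℝ) < ε₀ n →
        |fatness (neighborlyCubical n hn ε) - 5| < δ ∧
        |complexity (neighborlyCubical n hn ε) - 8| < δ := by
    intro δ hδ
    obtain ⟨N, hN⟩ := exists_nat_gt (40 / δ)
    refine ⟨N, fun n hn hNn ε h0 h1 => ?_⟩
    obtain ⟨hF, hC⟩ := (hparam n ε h0 h1).abs_fatness_complexity_le hn
    have hlt : (40 : ℝ) / n < δ := by
      have hn0 : (0 : ℝ) < n := by exact_mod_cast (by omega : 0 < n)
      rw [div_lt_iff₀ hδ] at hN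
      rw [div_lt_iff₀ hn0]
      have : (N : ℝ) ≤ n := by exact_mod_cast hNn
      nlinarith
    exact ⟨hF.trans_lt hlt, hC.trans_lt hlt⟩
  refine ⟨ε₀, hpos, fun n hn ε h0 h1 => ?_, hlim, fun δ hδ => ?_⟩
  · have hε := hparam n ε h0 h1
    exact ⟨hε.isPolytope_deformedCube, combEquiv_deformedCube hε.toSmallParam,
      hε.isFullPolytope_neighborlyCubical hn, hε.isRational_neighborlyCubical hn,
      hε.isCubical_neighborlyCubical hn, hε.nonempty_graph_iso hn, hε.flagVector_eq hn⟩
  · obtain ⟨N, hN⟩ := hlim δ hδ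
    have hn : 4 ≤ N + 4 := by omega
    obtain ⟨q, hq0, hq1⟩ := exists_rat_btwn (hpos (N + 4))
    have hq : 0 < q := by exact_mod_cast hq0
    have hε := hparam (N + 4) q hq hq1
    exact ⟨neighborlyCubical (N + 4) hn q, hε.isFullPolytope_neighborlyCubical hn,
      hε.isRational_neighborlyCubical hn, hN (N + 4) hn (by omega) q hq hq1⟩
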